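/- Let $\overline{\mathbb Q}\subset\mathbb C$ be the field of algebraic numbers. A power series $\sum_{n\ge 0}\frac{a_n}{n!}z^n$ with $a_n\in\overline{\mathbb Q}$ is an $E$-function if it satisfies a non-zero linear differential equation over $\overline{\mathbb Q}(z)$, the numbers $|\sigma(a_n)|$ ($\sigma\in\mathrm{Gal}(\overline{\mathbb Q}/\mathbb Q)$) are bounded by $C^{n+1}$ for some constant $C>0$, and the least common denominator of $a_0,\dots,a_n$ grows at most exponentially in $n$. In that case $\sum_{n\ge 0} a_nx^n$ is called a $G$-function and $\sum_{n\ge0} n!\,a_nz^n$ an arithmetic Gevrey series of order $1$. Let $\mathfrak f(z)=\sum_{n\ge0} n!\,a_nz^n$ be an arithmetic Gevrey series of order $1$. A real number $\theta$ is not an anti-Stokes direction of $\mathfrak f$ if $\mathfrak f(1/z)$ is $1$-summable in the direction $\theta$, that is, if $\sum a_nx^n$ extends to a holomorphic function $B$ on the union of a disc centred at $0$ and an open sector around the ray $\arg x=-\theta$, with $B(x)=O(e^{K|x|})$ on the sector for every $K>0$. The $1$-sum in the direction $\theta$ is then given, for $\mathrm{Re}(ze^{-i\theta})>0$, by $\mathfrak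 f_\theta(1/z)=z\int_0^{\infty e^{-i\theta}}B(x)e^{-xz}\,dx$. A mixed function is a formal series $\Psi(z)=\sum_{n\in\mathbb Z}a_nz^n$ such that $F(z)=\sum_{n\ge0}a_nz^n$ is an $E$-function and $\mathfrak f(w)=\sum_{n\ge1}a_{-n}w^n$ is an arithmetic Gevrey series of order $1$; put $\Psi_\theta(z)=F(z)+\mathfrak f_\theta(1/z)$, the anti-Stokes directions of $\Psi$ being those of $\mathfrak f$. Let $\mathbf E$ be the set of values of $E$-functions at algebraic points, $\mathbf D$ the set of values $\mathfrak f_\theta(1)$ of arithmetic Gevrey series $\mathfrak f$ of order $1$, and $\mathbf M_G$ the set of values $\Psi_\theta(1)$ of mixed functions $\Psi$, where in both cases $\theta=0$ if $0$ is not an anti-Stokes direction, and $\theta>0$ is sufficiently small otherwise. For $a\in\mathbb Q$, $a>0$, and an integer $s\ge0$ put $$E_{a,s+1}(z)=\sum_{n=0}^\infty\frac{z^n}{n!(n+a)^{s+1}},\qquad \mathfrak f_{a,s+1}(z)=\sum_{n=0}^\infty n!\,u_{a,s,n}z^n,\quad\text{where } (1+x)^{a-1}\log(1+x)^s=\sum_{n=0}^\infty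 u_{a,s,n}x^n .$$ Proposition. One has $\mathbf M_G=\mathbf E+\mathbf D$. For every integer $s\ge0$ and every rational $a>0$, $$\Gamma^{(s)}(a)\in e^{-1}\mathbf M_G=e^{-1}(\mathbf E+\mathbf D).$$ Moreover $E_{a,s+1}$ is an $E$-function, $\mathfrak f_{a,s+1}$ is an arithmetic Gevrey series of order $1$, $0$ is not an anti-Stokes direction of $\mathfrak f_{a,s+1}$, the $1$-sum of $\mathfrak f_{a,s+1}$ in the direction $0$ satisfies $\mathfrak f_{a,s+1;0}(1)=\int_0^\infty(1+t)^{a-1}\log(1+t)^s e^{-t}\,dt$, and $$\Gamma^{(s)}(a)=(-1)^s s!\,E_{a,s+1}(-1)+e^{-1}\mathfrak f_{a,s+1;0}(1).$$ -/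

import Mathlib

open scoped PowerSeries Pointwise Topology

noncomputable section

/-- The field of algebraic numbers, embedded in `ℂ`. -/
abbrev Qbar : Type := ↥(algebraicClosure ℚ ℂ)

/-- `F` is holonomic: it is a solution of a non-zero linear differential equation
`p_r F^(r) + ... + p_1 F' + p_0 F = 0` whose coefficients are polynomials over `Qbar`
(equivalently, rational functions, after clearing denominators). -/
def IsHolonomic (F : Qbar⟦X⟧) : Prop :=
  ∃ (r : ℕ) (p : ℕ → Polynomial Qbar), p r ≠ 0 ∧
    ∑ i ∈ Finset.range (r + 1),
      (p i : Qbar⟦X⟧) * (⇑(PowerSeries.derivative Qbar))^[i] F = 0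

/-- The absolute values of all Galois conjugates of `a n` grow at most exponentially in `n`. -/
def ConjugatesGrowAtMostExp (a : ℕ → Qbar) : Prop :=
  ∃ C : ℝ, 0 < C ∧ ∀ (σ : Qbar ≃ₐ[ℚ] Qbar) (n : ℕ), ‖((σ (a n) : Qbar) : ℂ)‖ ≤ C ^ (n + 1)

/-- The least common denominator of `a 0, ..., a n` (the least positive integer `d` such that
all `d * a k`, `k ≤ n`, are algebraic integers) grows at most exponentially in `n`. -/
def DenominatorsGrowAtMostExp (a : ℕ → Qbar) : Prop :=
  ∃ D : ℕ, 0 < D ∧ ∀ n : ℕ, ∃ d : ℕ, 0 < d ∧ d ≤ D ^ (n + 1) ∧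
    ∀ k ≤ n, IsIntegral ℤ ((d : Qbar) * a k)

/-- `F = ∑ (a n / n!) x ^ n` is an `E`-function. -/
def IsEFunction (F : Qbar⟦X⟧) : Prop :=
  IsHolonomic F ∧
    ConjugatesGrowAtMostExp (fun n => (n.factorial : Qbar) * PowerSeries.coeff n F) ∧
    DenominatorsGrowAtMostExp (fun n => (n.factorial : Qbar) * PowerSeries.coeff n F)

/-- `∑ a n x ^ n` is a `G`-function when `∑ (a n / n!) x ^ n` is an `E`-function. -/
def IsGFunction (G : Qbar⟦X⟧) : Prop :=
  IsEFunction (PowerSeries.mk fun n => PowerSeries.coeff n G / (n.factorial : Qbar))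

/-- The formal Borel transform `∑ c n z ^ n ↦ ∑ (c n / n!) x ^ n`. -/
def borelTransform (f : Qbar⟦X⟧) : Qbar⟦X⟧ :=
  PowerSeries.mk fun n => PowerSeries.coeff n f / (n.factorial : Qbar)

/-- Arithmetic Gevrey series of order `1`: the series `∑ n! a n z ^ n`
such that `∑ a n x ^ n` is a `G`-function. -/
def IsAntieFunction (f : Qbar⟦X⟧) : Prop :=
  IsGFunction (borelTransform f)

/-- `w` is the (complex) sum of the convergent series `F(z)`. -/
def HasValueAt (F : Qbar⟦X⟧) (z w : ℂ) : Prop :=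
  HasSum (fun n : ℕ => ((PowerSeries.coeff n F : Qbar) : ℂ) * z ^ n) w

/-- The open sector, of half-opening `ε`, around the ray `arg x = -θ`. -/
def sectorAround (θ ε : ℝ) : Set ℂ :=
  {x : ℂ | x ≠ 0 ∧ |Complex.arg (x * Complex.exp (θ * Complex.I))| < ε}

/-- `B` is a holomorphic continuation of the Borel transform of `f` to a neighbourhood of
`0` together with an open sector around the ray `arg x = -θ`, with growth at most
`exp (K |x|)` on the sector for every `K > 0`. The direction `θ` refers to the variable `z`
in `f(1/z)`, hence the ray `arg x = -θ` in the Borel plane. That every `K > 0` is allowed means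
that the `1`-sum of `f(1/z)` is holomorphic at all `z ≠ 0` of a large sector bisected by `θ`. -/
def IsBorelContinuation (f : Qbar⟦X⟧) (θ : ℝ) (B : ℂ → ℂ) : Prop :=
  ∃ ε : ℝ, 0 < ε ∧
    DifferentiableOn ℂ B (Metric.ball 0 ε ∪ sectorAround θ ε) ∧
    (∀ x ∈ Metric.ball (0 : ℂ) ε, HasValueAt (borelTransform f) x (B x)) ∧
    ∀ K : ℝ, 0 < K → ∃ C : ℝ, ∀ x ∈ sectorAround θ ε, ‖B x‖ ≤ C * Real.exp (K * ‖x‖)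

/-- `θ` is an anti-Stokes direction of `f(1/z)`: the series is not `1`-summable in the
direction `θ`. -/
def IsAntiStokes (f : Qbar⟦X⟧) (θ : ℝ) : Prop :=
  ¬ ∃ B : ℂ → ℂ, IsBorelContinuation f θ B

/-- `θ` is not anti-Stokes for `f`, and the `1`-sum (Borel-Laplace sum) of `f(1/z)` in the
direction `θ`, evaluated at a point `z` of the half-plane bisected by `θ`, is
`w = z ∫ B(x) exp (-x z) dx`, the integral being along the ray `arg x = -θ`. -/
def HasOneSumAt (f : Qbar⟦X⟧) (θ : ℝ) (z w : ℂ) : Prop :=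
  0 < (z * Complex.exp (-(θ * Complex.I))).re ∧
  ∃ B : ℂ → ℂ, IsBorelContinuation f θ B ∧
    w = z * ∫ t in Set.Ioi (0 : ℝ),
      B (t * Complex.exp (-(θ * Complex.I))) *
        Complex.exp (-(t * Complex.exp (-(θ * Complex.I)) * z)) *
        Complex.exp (-(θ * Complex.I))

/-- The ring `E` of all values of `E`-functions at algebraic points. -/
def valuesE : Set ℂ :=
  {w | ∃ F : Qbar⟦X⟧, IsEFunction F ∧ ∃ ξ : Qbar, HasValueAt F (ξ : ℂ) w}

/-- The ring `D` of all `f_θ(1)`, where `f` is an arithmetic Gevrey series of order `1`, with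
`θ = 0` if it is not an anti-Stokes direction, and `θ > 0` sufficiently small otherwise. -/
def valuesD : Set ℂ :=
  {w | ∃ f : Qbar⟦X⟧, IsAntieFunction f ∧
    ((¬ IsAntiStokes f 0 ∧ HasOneSumAt f 0 1 w) ∨
      (IsAntiStokes f 0 ∧ ∀ᶠ θ : ℝ in 𝓝[>] 0, HasOneSumAt f θ 1 w))}

/-- The part `∑_{n ≥ 0} a n z ^ n` of a formal series `∑_{n ∈ ℤ} a n z ^ n`. -/
def plusPart (Ψ : ℤ → Qbar) : Qbar⟦X⟧ :=
  PowerSeries.mk fun n => Ψ n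

/-- The part `∑_{n ≥ 1} a (-n) z ^ (-n)` of a formal series `∑_{n ∈ ℤ} a n z ^ n`, as a power
series in `1/z`. -/
def minusPart (Ψ : ℤ → Qbar) : Qbar⟦X⟧ :=
  PowerSeries.mk fun n => if n = 0 then 0 else Ψ (-(n : ℤ))

/-- Mixed (arithmetic Gevrey) functions: formal series `∑_{n ∈ ℤ} Ψ n z ^ n`. -/
def IsMixedFunction (Ψ : ℤ → Qbar) : Prop :=
  IsEFunction (plusPart Ψ) ∧ IsAntieFunction (minusPart Ψ)

/-- `Ψ_θ(z) = w`, where `Ψ_θ(z) = F(z) + f_θ(1/z)` for `Ψ = F(z) + f(1/z)`. -/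
def MixedHasValueAt (Ψ : ℤ → Qbar) (θ : ℝ) (z w : ℂ) : Prop :=
  ∃ u v : ℂ, HasValueAt (plusPart Ψ) z u ∧ HasOneSumAt (minusPart Ψ) θ z v ∧ w = u + v

/-- The set `M_G` of values `Ψ_θ(1)` of mixed functions, with `θ = 0` if it is not an
anti-Stokes direction of `Ψ`, and `θ > 0` sufficiently small otherwise. -/
def valuesMixed : Set ℂ :=
  {w | ∃ Ψ : ℤ → Qbar, IsMixedFunction Ψ ∧
    ((¬ IsAntiStokes (minusPart Ψ) 0 ∧ MixedHasValueAt Ψ 0 1 w) ∨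
      (IsAntiStokes (minusPart Ψ) 0 ∧ ∀ᶠ θ : ℝ in 𝓝[>] 0, MixedHasValueAt Ψ θ 1 w))}

/-- The series `E_{a,s}(z) = ∑ z ^ n / (n! (n + a) ^ s)`. -/
def seriesE (a : ℚ) (s : ℕ) : Qbar⟦X⟧ :=
  PowerSeries.mk fun n => 1 / ((n.factorial : Qbar) * ((n : Qbar) + (a : Qbar)) ^ s)

/-- The series `f_{a,k+1}(z) = ∑ n! u_{a,k,n} z ^ n`, where
`(1 + x) ^ (a - 1) log (1 + x) ^ k = ∑ u_{a,k,n} x ^ n`. -/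
def seriesAntie (a : ℚ) (k : ℕ) : Qbar⟦X⟧ :=
  PowerSeries.mk fun n => (n.factorial : Qbar) *
    PowerSeries.coeff n
      (PowerSeries.binomialSeries Qbar (a - 1) * PowerSeries.log Qbar ^ k)

end

/-! Cut the integral of t^(a-1) log(t)^s e^(-t) over (0, ∞), which is the s-th derivative of Γ at a,
at t = 1. On (0, 1] expand e^(-t) and integrate termwise: each term is a derivative of 1/z at z = n
+ a, and the sum is (-1)^s s! E_{a,s+1}(-1). On (1, ∞) substitute t ↦ 1 + t: this produces e^(-1)
times the Laplace integral of (1+x)^(a-1) log(1+x)^s, the Borel transform of the divergent series.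
That function is holomorphic off the cut (-∞, -1] and grows at most polynomially in a sector around
the positive axis, so direction 0 is harmless. These are
`exists_hasValueAt_seriesE_iteratedDeriv_Gamma` and `isBorelContinuation_seriesAntie`.

The arithmetic conditions have two sources. Holonomicity follows once a series lies in a finitely
generated module over the polynomials that is stable under differentiation up to polynomial factors
(`isHolonomic_of_mem_span`). Denominators are controlled by Chebyshev's bound for lcm(1, ..., n) and
by the denominators of rational binomial coefficients; both growth conditions survive convolution.

For the equality of sets of values, E-functions are stable under z ↦ ξz, so every algebraic point
may be moved to 1, and the constant term of the Gevrey series, which a mixed function must carry in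
its E-part, can be transferred there because the 1-sum of a constant is that constant. Membership of
the Gamma derivatives in e^(-1) M_G then uses that e E_{a,s+1}(-1) is itself the value at -1 of the
E-function e^(-z) E_{a,s+1}(z). -/

/-! ### Holonomicity from finitely generated modules -/

theorem polynomial_smul_eq_coe_mul (q : Polynomial Qbar) (F : Qbar⟦X⟧) :
    q • F = (q : Qbar⟦X⟧) * F := by
  rw [Algebra.smul_def, PowerSeries.algebraMap_apply']
  simp

theorem derivative_polynomial_smul (q : Polynomial Qbar) (F : Qbar⟦X⟧) :
    PowerSeries.derivative Qbar (q • F) =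
      Polynomial.derivative q • F + q • PowerSeries.derivative Qbar F := by
  simp only [polynomial_smul_eq_coe_mul, Derivation.leibniz, smul_eq_mul,
    PowerSeries.derivative_coe]
  ring

/-- By the Leibniz rule the condition passes from generators to sums, with the product of the two
multipliers, and to polynomial multiples, with the same multiplier. -/
theorem exists_smul_derivative_mem {V : Submodule (Polynomial Qbar) Qbar⟦X⟧} {S : Set Qbar⟦X⟧}
    (hV : V = Submodule.span (Polynomial Qbar) S)
    (h : ∀ x ∈ S, ∃ q : Polynomial Qbar, q ≠ 0 ∧ q • PowerSeries.derivative Qbar x ∈ V)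
    {x : Qbar⟦X⟧} (hx : x ∈ V) :
    ∃ q : Polynomial Qbar, q ≠ 0 ∧ q • PowerSeries.derivative Qbar x ∈ V := by
  have hx' := hx
  rw [hV] at hx'
  induction hx' using Submodule.span_induction with
  | mem y hy => exact h y hy
  | zero => exact ⟨1, one_ne_zero, by simp⟩
  | add x y hxS hyS ihx ihy =>
    obtain ⟨q, hq, hqx⟩ := ihx (hV ▸ hxS)
    obtain ⟨q', hq', hqy⟩ := ihy (hV ▸ hyS)
    refine ⟨q * q', mul_ne_zero hq hq', ?_⟩
    rw [map_add, smul_add]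
    refine V.add_mem ?_ ?_
    · rw [mul_comm, mul_smul]
      exact V.smul_mem _ hqx
    · rw [mul_smul]
      exact V.smul_mem _ hqy
  | smul r x hxS ihx =>
    obtain ⟨q, hq, hqx⟩ := ihx (hV ▸ hxS)
    refine ⟨q, hq, ?_⟩
    rw [derivative_polynomial_smul, smul_add, smul_comm q r]
    exact V.add_mem (V.smul_mem _ (V.smul_mem _ (hV ▸ hxS))) (V.smul_mem _ hqx)

/-- An element of a finitely generated module over the polynomials which is stable under
differentiation up to non-zero polynomial factors is holonomic. -/
theorem isHolonomic_of_mem_span {S : Set Qbar⟦X⟧} (hS : S.Finite)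
    (h : ∀ x ∈ S, ∃ q : Polynomial Qbar, q ≠ 0 ∧
      q • PowerSeries.derivative Qbar x ∈ Submodule.span (Polynomial Qbar) S)
    {F : Qbar⟦X⟧} (hF : F ∈ Submodule.span (Polynomial Qbar) S) : IsHolonomic F := by
  set V := Submodule.span (Polynomial Qbar) S with hV
  have key : ∀ k : ℕ, ∃ q : Polynomial Qbar, q ≠ 0 ∧
      q • (⇑(PowerSeries.derivative Qbar))^[k] F ∈ V := by
    intro k
    induction k with
    | zero => exact ⟨1, one_ne_zero, by simpa using hF⟩
    | succ k ih =>
      obtain ⟨q, hq, hqF⟩ := ih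
      obtain ⟨q', hq', hq'F⟩ := exists_smul_derivative_mem hV h hqF
      -- Write G for the k-th derivative of F. In q q' (qG)' the unwanted term is q q' q'
      -- _derivative_ of q times G; multiplying by q first makes it a multiple of qG, which lies in
      -- V and can be subtracted.
      refine ⟨q * q' * q, by simp [hq, hq'], ?_⟩
      have h1 := V.sub_mem (V.smul_mem q hq'F)
        (V.smul_mem (q' * Polynomial.derivative q) hqF)
      rw [Function.iterate_succ_apply']
      convert h1 using 1
      rw [derivative_polynomial_smul]
      module
  choose q hq hqF using key
  -- An infinite family inside the span of a finite set is linearly dependent; the dependence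
  -- relation is the differential equation.
  have hdep : ¬ LinearIndependent (Polynomial Qbar)
      fun k => q k • (⇑(PowerSeries.derivative Qbar))^[k] F := by
    intro hli
    have := hS.to_subtype
    have := hli.finite_of_le_span_finite _ S (by rintro _ ⟨k, rfl⟩; exact hqF k)
    exact not_finite ℕ
  obtain ⟨s, g, hsum, i, his, hgi⟩ := not_linearIndependent_iff.mp hdep
  set p : ℕ → Polynomial Qbar := fun k => if k ∈ s then g k * q k else 0 with hp
  have hpi : p i ≠ 0 := by simp [hp, his, hgi, hq]
  have hne : (s.filter fun k => p k ≠ 0).Nonempty := ⟨i, by simp [his, hpi]⟩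
  -- The order is the largest index with a non-zero coefficient, since the definition asks for a
  -- non-zero leading coefficient.
  set r := (s.filter fun k => p k ≠ 0).max' hne with hr
  have hrm := (s.filter fun k => p k ≠ 0).max'_mem hne
  rw [← hr, Finset.mem_filter] at hrm
  refine ⟨r, p, hrm.2, ?_⟩
  rw [← hsum]
  have hlt : ∀ k, p k ≠ 0 → k < r + 1 := by
    intro k hk
    have hks : k ∈ s := by
      by_contra hks
      exact hk (by simp [hp, hks])
    exact Nat.lt_succ_of_le (Finset.le_max' _ _ (by simp [hks, hk]))
  have h2 : ∀ k ∈ s, g k • q k • (⇑(PowerSeries.derivative Qbar))^[k] F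
      = (p k : Qbar⟦X⟧) * (⇑(PowerSeries.derivative Qbar))^[k] F := by
    intro k hk
    rw [← polynomial_smul_eq_coe_mul, smul_smul]
    simp [hp, hk]
  rw [Finset.sum_congr rfl h2]
  refine (Finset.sum_subset_zero_on_sdiff
    (s₁ := (s.filter fun k => p k ≠ 0)) ?_ ?_ fun _ _ => rfl).symm.trans
    (Finset.sum_subset_zero_on_sdiff (Finset.filter_subset _ _) ?_ fun _ _ => rfl)
  · intro k hk
    exact Finset.mem_range.mpr (hlt k (Finset.mem_filter.mp hk).2)
  · intro k hk
    have : p k = 0 := by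
      by_contra hk0
      have hks : k ∈ s := by
        by_contra hks
        exact hk0 (by simp [hp, hks])
      simp [hks, hk0] at hk
    simp [this]
  · intro k hk
    have : p k = 0 := by
      by_contra hk0
      simp only [Finset.mem_sdiff, Finset.mem_filter, not_and, not_not] at hk
      exact hk0 (hk.2 hk.1)
    simp [this]

/-! ### Affine changes of holonomic series -/

theorem derivative_rescale (ξ : Qbar) (F : Qbar⟦X⟧) :
    PowerSeries.derivative Qbar (PowerSeries.rescale ξ F) =
      ξ • PowerSeries.rescale ξ (PowerSeries.derivative Qbar F) := by
  ext n : 1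
  simp only [PowerSeries.coeff_derivative, PowerSeries.coeff_rescale, PowerSeries.coeff_smul,
    smul_eq_mul]
  ring

theorem rescale_polynomial_coe (ξ : Qbar) (p : Polynomial Qbar) :
    PowerSeries.rescale ξ (p : Qbar⟦X⟧) =
      ((p.comp (Polynomial.C ξ * Polynomial.X) : Polynomial Qbar) : Qbar⟦X⟧) := by
  ext n : 1
  rw [PowerSeries.coeff_rescale, Polynomial.coeff_coe, Polynomial.coeff_coe,
    Polynomial.comp_C_mul_X_coeff, mul_comm]

theorem comp_C_mul_X_ne_zero {ξ : Qbar} (hξ : ξ ≠ 0) {p : Polynomial Qbar} (hp : p ≠ 0) :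
    p.comp (Polynomial.C ξ * Polynomial.X) ≠ 0 := by
  intro h
  refine hp (Polynomial.ext fun n => ?_)
  have := congrArg (fun q => Polynomial.coeff q n) h
  simpa [Polynomial.comp_C_mul_X_coeff, hξ] using this

theorem scalar_smul_eq_polynomial_smul (c : Qbar) (F : Qbar⟦X⟧) :
    c • F = Polynomial.C c • F := by
  rw [polynomial_smul_eq_coe_mul, Polynomial.coe_C, PowerSeries.smul_eq_C_mul]

theorem isHolonomic_C (b : Qbar) : IsHolonomic (PowerSeries.C b) := by
  refine isHolonomic_of_mem_span (S := {1}) (Set.finite_singleton _) ?_ ?_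
  · rintro _ rfl
    exact ⟨1, one_ne_zero, by simp⟩
  · rw [← mul_one (PowerSeries.C b), ← PowerSeries.smul_eq_C_mul, scalar_smul_eq_polynomial_smul]
    exact Submodule.smul_mem _ _ (Submodule.subset_span rfl)

/-- The constant 1 and the rescaled derivatives of F of order below r generate a suitable module:
the rescaled equation expresses the r-th one, times the leading coefficient, through the others.
That coefficient stays non-zero because ξ ≠ 0; the case ξ = 0 is a constant. -/
theorem IsHolonomic.affine {F : Qbar⟦X⟧} (hF : IsHolonomic F) (c ξ b : Qbar) :
    IsHolonomic (PowerSeries.C c * PowerSeries.rescale ξ F + PowerSeries.C b) := by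
  rcases eq_or_ne ξ 0 with rfl | hξ
  · rw [PowerSeries.rescale_zero_apply, ← map_mul, ← map_add]
    exact isHolonomic_C _
  obtain ⟨r, p, hpr, hsum⟩ := hF
  set D := (PowerSeries.derivative Qbar) with hD
  set S : Set Qbar⟦X⟧ :=
    insert 1 ((fun i => PowerSeries.rescale ξ (D^[i] F)) '' Set.Iio r) with hS
  have hSfin : S.Finite := ((Set.finite_Iio r).image _).insert _
  have hmem : ∀ i < r, PowerSeries.rescale ξ (D^[i] F) ∈ Submodule.span (Polynomial Qbar) S :=
    fun i hi => Submodule.subset_span (Or.inr ⟨i, hi, rfl⟩)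
  have hone : (1 : Qbar⟦X⟧) ∈ Submodule.span (Polynomial Qbar) S :=
    Submodule.subset_span (Or.inl rfl)
  refine isHolonomic_of_mem_span hSfin ?_ ?_
  · rintro x (rfl | ⟨i, hi, rfl⟩)
    · exact ⟨1, one_ne_zero, by simp⟩
    · dsimp only
      rw [Set.mem_Iio] at hi
      rcases Nat.lt_or_ge (i + 1) r with hi' | hi'
      · refine ⟨1, one_ne_zero, ?_⟩
        rw [one_smul, derivative_rescale, ← Function.iterate_succ_apply' (⇑D),
          scalar_smul_eq_polynomial_smul]
        exact Submodule.smul_mem _ _ (hmem _ hi')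
      · obtain rfl : r = i + 1 := le_antisymm hi' hi
        refine ⟨_, comp_C_mul_X_ne_zero hξ hpr, ?_⟩
        rw [derivative_rescale, ← Function.iterate_succ_apply' (⇑D), smul_comm,
          scalar_smul_eq_polynomial_smul]
        refine Submodule.smul_mem _ _ ?_
        rw [Finset.sum_range_succ] at hsum
        have h2 := congrArg (PowerSeries.rescale ξ) hsum
        rw [map_add, map_sum, map_mul, map_zero] at h2
        rw [polynomial_smul_eq_coe_mul, ← rescale_polynomial_coe, eq_neg_of_add_eq_zero_right h2]
        refine Submodule.neg_mem _ (Submodule.sum_mem _ fun j hj => ?_)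
        rw [map_mul, rescale_polynomial_coe, ← polynomial_smul_eq_coe_mul]
        exact Submodule.smul_mem _ _ (hmem _ (Finset.mem_range.mp hj))
  · refine Submodule.add_mem _ ?_ ?_
    · rw [← PowerSeries.smul_eq_C_mul, scalar_smul_eq_polynomial_smul]
      refine Submodule.smul_mem _ _ ?_
      rcases Nat.eq_zero_or_pos r with rfl | hr
      · have : F = 0 := by
          simpa [hpr] using hsum
        simp [this]
      · exact hmem 0 hr
    · rw [← mul_one (PowerSeries.C b), ← PowerSeries.smul_eq_C_mul,
        scalar_smul_eq_polynomial_smul]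
      exact Submodule.smul_mem _ _ hone

/-! ### Differential equations of the series involved -/

theorem natCast_add_ratCast_ne_zero {a : ℚ} (ha : 0 < a) (n : ℕ) :
    (n : Qbar) + (a : Qbar) ≠ 0 := by
  have : (n : ℚ) + a ≠ 0 := by positivity
  exact_mod_cast this

theorem derivative_seriesE_zero (a : ℚ) :
    PowerSeries.derivative Qbar (seriesE a 0) = seriesE a 0 := by
  ext n : 1
  simp only [PowerSeries.coeff_derivative, seriesE, PowerSeries.coeff_mk, pow_zero, mul_one,
    Nat.factorial_succ]
  have := Nat.cast_add_one_ne_zero (R := Qbar) n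
  push_cast
  field_simp

/-- The Euler operator multiplies the n-th coefficient by n, so adding a to it cancels one factor n
+ a of the denominator. -/
theorem X_mul_derivative_seriesE_succ {a : ℚ} (ha : 0 < a) (s : ℕ) :
    PowerSeries.X * PowerSeries.derivative Qbar (seriesE a (s + 1)) =
      seriesE a s - (a : Qbar) • seriesE a (s + 1) := by
  ext n : 1
  have h0 := natCast_add_ratCast_ne_zero ha n
  have hf : (n.factorial : Qbar) ≠ 0 := by exact_mod_cast n.factorial_ne_zero
  have h1 : PowerSeries.coeff n
      (PowerSeries.X * PowerSeries.derivative Qbar (seriesE a (s + 1))) =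
      n * PowerSeries.coeff n (seriesE a (s + 1)) := by
    cases n with
    | zero => simp
    | succ n =>
      rw [PowerSeries.coeff_succ_X_mul, PowerSeries.coeff_derivative]
      push_cast
      ring
  rw [h1, map_sub, PowerSeries.coeff_smul]
  simp only [seriesE, PowerSeries.coeff_mk, smul_eq_mul]
  field_simp
  ring

/-- The factor W is there to treat 1 and e^(-z) together. The products of W with `seriesE a j`, j ≤
s, span a module stable under the Euler operator. -/
theorem isHolonomic_mul_seriesE {a : ℚ} (ha : 0 < a) (s : ℕ) {W : Qbar⟦X⟧} {β : Qbar}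
    (hW : PowerSeries.derivative Qbar W = β • W) : IsHolonomic (W * seriesE a s) := by
  set S : Set Qbar⟦X⟧ := (fun j => W * seriesE a j) '' Set.Iic s with hS
  have hmem : ∀ i ≤ s, W * seriesE a i ∈ Submodule.span (Polynomial Qbar) S :=
    fun i hi => Submodule.subset_span ⟨i, hi, rfl⟩
  refine isHolonomic_of_mem_span ((Set.finite_Iic s).image _) ?_ (hmem s le_rfl)
  rintro _ ⟨j, hj, rfl⟩
  rw [Set.mem_Iic] at hj
  refine ⟨Polynomial.X, Polynomial.X_ne_zero, ?_⟩
  cases j with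
  | zero =>
    refine Submodule.smul_mem _ _ ?_
    have : PowerSeries.derivative Qbar (W * seriesE a 0) =
        Polynomial.C (1 + β) • (W * seriesE a 0) := by
      rw [← scalar_smul_eq_polynomial_smul]
      simp only [Derivation.leibniz, hW, derivative_seriesE_zero, PowerSeries.smul_eq_C_mul,
        smul_eq_mul, map_add, map_one]
      ring
    rw [this]
    exact Submodule.smul_mem _ _ (hmem 0 hj)
  | succ j =>
    have : (Polynomial.X : Polynomial Qbar) • PowerSeries.derivative Qbar
        (W * seriesE a (j + 1)) = W * seriesE a j +
        (Polynomial.C β * Polynomial.X - Polynomial.C (a : Qbar)) • (W * seriesE a (j + 1)) := by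
      have h := X_mul_derivative_seriesE_succ ha j
      simp only [polynomial_smul_eq_coe_mul, Derivation.leibniz, hW, PowerSeries.smul_eq_C_mul,
        smul_eq_mul, Polynomial.coe_X, Polynomial.coe_C, Polynomial.coe_sub,
        Polynomial.coe_mul] at h ⊢
      linear_combination W * h
    rw [this]
    exact Submodule.add_mem _ (hmem _ (by omega)) (Submodule.smul_mem _ _ (hmem _ hj))

theorem one_add_X_mul_derivative_binomialSeries (α : ℚ) :
    (1 + PowerSeries.X) * PowerSeries.derivative Qbar (PowerSeries.binomialSeries Qbar α) =
      (α : Qbar) • PowerSeries.binomialSeries Qbar α := by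
  have h : ∀ n : ℕ, (Ring.choose α (n + 1)) * (n + 1) = Ring.choose α n * (α - n) := by
    intro n
    simp only [Ring.choose_eq_smul, descPochhammer_succ_right, Polynomial.smeval_mul,
      Nat.factorial_succ, smul_eq_mul, Polynomial.smeval_sub, Polynomial.smeval_X,
      Polynomial.smeval_natCast, nsmul_eq_mul, pow_one, pow_zero, mul_one]
    push_cast
    field_simp
  ext n : 1
  rw [add_mul, one_mul, map_add]
  cases n with
  | zero =>
    have := h 0
    simp only [PowerSeries.coeff_derivative, PowerSeries.binomialSeries_coeff,
      PowerSeries.coeff_smul]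
    simp
  | succ n =>
    have := congrArg (fun x : ℚ => (x : Qbar)) (h (n + 1))
    rw [PowerSeries.coeff_succ_X_mul]
    simp only [PowerSeries.coeff_derivative, PowerSeries.binomialSeries_coeff,
      PowerSeries.coeff_smul, Rat.smul_one_eq_cast, smul_eq_mul]
    push_cast at this ⊢
    linear_combination this

theorem one_add_X_mul_derivative_log :
    (1 + PowerSeries.X) * PowerSeries.derivative Qbar (PowerSeries.log Qbar) = 1 := by
  rw [PowerSeries.deriv_log]
  ext n : 1
  rw [add_mul, one_mul, map_add]
  cases n with
  | zero => simp
  | succ n =>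
    rw [PowerSeries.coeff_succ_X_mul]
    simp [pow_succ, PowerSeries.coeff_one]

/-- The series `(1 + x) ^ α log (1 + x) ^ k`. -/
noncomputable def binomialLogSeries (α : ℚ) (k : ℕ) : Qbar⟦X⟧ :=
  PowerSeries.binomialSeries Qbar α * PowerSeries.log Qbar ^ k

/-- For k = 0 the truncated k - 1 is harmless, its coefficient being 0. -/
theorem one_add_X_mul_derivative_binomialLogSeries (α : ℚ) (k : ℕ) :
    (1 + PowerSeries.X) * PowerSeries.derivative Qbar (binomialLogSeries α k) =
      (α : Qbar) • binomialLogSeries α k + (k : Qbar) • binomialLogSeries α (k - 1) := by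
  have h1 := one_add_X_mul_derivative_binomialSeries α
  have h2 := one_add_X_mul_derivative_log
  simp only [binomialLogSeries, Derivation.leibniz, Derivation.leibniz_pow,
    PowerSeries.smul_eq_C_mul, smul_eq_mul, nsmul_eq_mul, map_natCast] at h1 h2 ⊢
  linear_combination (PowerSeries.log Qbar ^ k) * h1 +
    (PowerSeries.binomialSeries Qbar α) * k * PowerSeries.log Qbar ^ (k - 1) * h2

/-- Under the Borel transform, differentiation D becomes D X D = X D² + D, while X D is unchanged.
-/
theorem borelTransform_one_add_X_mul_derivative (G : Qbar⟦X⟧) :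
    borelTransform ((1 + PowerSeries.X) * PowerSeries.derivative Qbar G) =
      PowerSeries.X * PowerSeries.derivative Qbar
        (PowerSeries.derivative Qbar (borelTransform G)) +
      (1 + PowerSeries.X) * PowerSeries.derivative Qbar (borelTransform G) := by
  ext n : 1
  simp only [add_mul, one_mul, map_add]
  simp only [borelTransform, PowerSeries.coeff_mk, map_add]
  cases n with
  | zero => simp [PowerSeries.coeff_derivative]
  | succ n =>
    have hf : (n.factorial : Qbar) ≠ 0 := by exact_mod_cast n.factorial_ne_zero
    have h1 : ((n : Qbar) + 1) ≠ 0 := by exact_mod_cast n.succ_ne_zero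
    have h2 : ((n : Qbar) + 1 + 1) ≠ 0 := by exact_mod_cast (n + 1).succ_ne_zero
    simp only [PowerSeries.coeff_succ_X_mul, PowerSeries.coeff_derivative, PowerSeries.coeff_mk,
      Nat.factorial_succ]
    push_cast
    field_simp
    ring

theorem borelTransform_add (F G : Qbar⟦X⟧) :
    borelTransform (F + G) = borelTransform F + borelTransform G := by
  ext n : 1
  simp [borelTransform, add_div]

theorem borelTransform_smul (c : Qbar) (F : Qbar⟦X⟧) :
    borelTransform (c • F) = c • borelTransform F := by
  ext n : 1
  simp [borelTransform, mul_div_assoc]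

/-- A G-function is defined through its Borel transform, so the equation is needed there. It has
order two in each Borel transform, so first derivatives are added to the generators. -/
theorem isHolonomic_borelTransform_binomialLogSeries (α : ℚ) (s : ℕ) :
    IsHolonomic (borelTransform (binomialLogSeries α s)) := by
  set U : ℕ → Qbar⟦X⟧ := fun k => borelTransform (binomialLogSeries α k) with hU
  set D := PowerSeries.derivative Qbar with hD
  set S : Set Qbar⟦X⟧ := U '' Set.Iic s ∪ (fun k => D (U k)) '' Set.Iic s with hS
  have hmem : ∀ i ≤ s, U i ∈ Submodule.span (Polynomial Qbar) S :=
    fun i hi => Submodule.subset_span (Or.inl ⟨i, hi, rfl⟩)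
  have hmem' : ∀ i ≤ s, D (U i) ∈ Submodule.span (Polynomial Qbar) S :=
    fun i hi => Submodule.subset_span (Or.inr ⟨i, hi, rfl⟩)
  refine isHolonomic_of_mem_span (((Set.finite_Iic s).image _).union ((Set.finite_Iic s).image _))
    ?_ (hmem s le_rfl)
  rintro _ (⟨k, hk, rfl⟩ | ⟨k, hk, rfl⟩)
  · exact ⟨1, one_ne_zero, by rw [one_smul]; exact hmem' k hk⟩
  · refine ⟨Polynomial.X, Polynomial.X_ne_zero, ?_⟩
    rw [Set.mem_Iic] at hk
    have h := borelTransform_one_add_X_mul_derivative (binomialLogSeries α k)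
    rw [one_add_X_mul_derivative_binomialLogSeries, borelTransform_add, borelTransform_smul,
      borelTransform_smul] at h
    have h' : (Polynomial.X : Polynomial Qbar) • D (D (U k)) =
        Polynomial.C (α : Qbar) • U k + Polynomial.C (k : Qbar) • U (k - 1) -
          (1 + Polynomial.X : Polynomial Qbar) • D (U k) := by
      rw [← scalar_smul_eq_polynomial_smul, ← scalar_smul_eq_polynomial_smul, h]
      simp only [polynomial_smul_eq_coe_mul, Polynomial.coe_X, Polynomial.coe_add,
        Polynomial.coe_one]
      ring
    rw [h']
    exact Submodule.sub_mem _ (Submodule.add_mem _ (Submodule.smul_mem _ _ (hmem k hk))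
      (Submodule.smul_mem _ _ (hmem _ (by omega)))) (Submodule.smul_mem _ _ (hmem' k hk))

/-! ### Growth of conjugates and denominators -/

theorem conjugatesGrowAtMostExp_of_le {a : ℕ → Qbar} {A B : ℝ} (hA : 0 ≤ A) (hB : 0 ≤ B)
    (h : ∀ (σ : Qbar ≃ₐ[ℚ] Qbar) (n : ℕ), ‖((σ (a n) : Qbar) : ℂ)‖ ≤ A * B ^ n) :
    ConjugatesGrowAtMostExp a := by
  refine ⟨(1 + A) * (1 + B), by positivity, fun σ n => (h σ n).trans ?_⟩
  rw [mul_pow]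
  gcongr
  · calc A ≤ 1 + A := by linarith
      _ ≤ (1 + A) ^ (n + 1) := le_self_pow₀ (by linarith) (by simp)
  · calc B ^ n ≤ (1 + B) ^ n := by gcongr; linarith
      _ ≤ (1 + B) ^ (n + 1) := pow_le_pow_right₀ (by linarith) (by simp)

/-- The weight w is 1 for a Cauchy product of coefficients and a binomial coefficient for a product
of exponential generating series. -/
theorem ConjugatesGrowAtMostExp.convolution {a b c : ℕ → Qbar} {w : ℕ × ℕ → ℕ}
    (ha : ConjugatesGrowAtMostExp a) (hb : ConjugatesGrowAtMostExp b)
    (hw : ∀ p, w p ≤ 2 ^ (p.1 + p.2))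
    (hc : ∀ n, c n = ∑ p ∈ Finset.HasAntidiagonal.antidiagonal n, (w p : Qbar) * (a p.1 * b p.2)) :
    ConjugatesGrowAtMostExp c := by
  obtain ⟨A, hA, ha⟩ := ha
  obtain ⟨B, hB, hb⟩ := hb
  -- The weights and the number n + 1 of terms are each at most 2^n, whence the 4. Replacing A, B by
  -- 1 + A, 1 + B makes the powers increase with the exponent.
  refine conjugatesGrowAtMostExp_of_le (A := (1 + A) * (1 + B))
    (B := 4 * ((1 + A) * (1 + B))) (by positivity) (by positivity) fun σ n => ?_
  set τ : Qbar →+* ℂ := (algebraMap Qbar ℂ).comp (σ : Qbar →+* Qbar) with hτ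
  have hτa : ∀ x : Qbar, ((σ x : Qbar) : ℂ) = τ x := fun _ => rfl
  simp only [hτa] at ha hb ⊢
  have hterm : ∀ p ∈ Finset.HasAntidiagonal.antidiagonal n, ‖τ ((w p : Qbar) * (a p.1 * b p.2))‖ ≤
      2 ^ n * ((1 + A) * (1 + B)) ^ (n + 1) := by
    intro p hp
    rw [Finset.HasAntidiagonal.mem_antidiagonal] at hp
    rw [map_mul, map_mul, map_natCast, norm_mul, norm_mul, Complex.norm_natCast, mul_pow]
    gcongr
    · have := hw p
      rw [hp] at this
      exact_mod_cast this
    · calc ‖τ (a p.1)‖ ≤ A ^ (p.1 + 1) := ha _ _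
        _ ≤ (1 + A) ^ (p.1 + 1) := by gcongr; linarith
        _ ≤ (1 + A) ^ (n + 1) := pow_le_pow_right₀ (by linarith) (by omega)
    · calc ‖τ (b p.2)‖ ≤ B ^ (p.2 + 1) := hb _ _
        _ ≤ (1 + B) ^ (p.2 + 1) := by gcongr; linarith
        _ ≤ (1 + B) ^ (n + 1) := pow_le_pow_right₀ (by linarith) (by omega)
  rw [hc, map_sum]
  refine (norm_sum_le_of_le _ hterm).trans ?_
  rw [Finset.sum_const, Finset.Nat.card_antidiagonal, nsmul_eq_mul]
  have h2 : ((n + 1 : ℕ) : ℝ) ≤ 2 ^ n := by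
    exact_mod_cast Nat.lt_two_pow_self (n := n)
  calc ((n + 1 : ℕ) : ℝ) * (2 ^ n * ((1 + A) * (1 + B)) ^ (n + 1))
      ≤ 2 ^ n * (2 ^ n * ((1 + A) * (1 + B)) ^ (n + 1)) := by gcongr
    _ = (1 + A) * (1 + B) * (4 * ((1 + A) * (1 + B))) ^ n := by
        rw [show (4 : ℝ) = 2 * 2 by norm_num, mul_pow _ ((1 + A) * (1 + B)), mul_pow (2 : ℝ) 2,
          pow_succ]
        ring

theorem DenominatorsGrowAtMostExp.convolution {a b c : ℕ → Qbar} {w : ℕ × ℕ → ℕ}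
    (ha : DenominatorsGrowAtMostExp a) (hb : DenominatorsGrowAtMostExp b)
    (hc : ∀ n, c n = ∑ p ∈ Finset.HasAntidiagonal.antidiagonal n, (w p : Qbar) * (a p.1 * b p.2)) :
    DenominatorsGrowAtMostExp c := by
  obtain ⟨A, hA, ha⟩ := ha
  obtain ⟨B, hB, hb⟩ := hb
  refine ⟨A * B, by positivity, fun n => ?_⟩
  obtain ⟨d, hd, hdA, hda⟩ := ha n
  obtain ⟨e, he, heB, heb⟩ := hb n
  refine ⟨d * e, by positivity, by rw [mul_pow]; gcongr, fun k hk => ?_⟩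
  rw [hc, Finset.mul_sum]
  refine IsIntegral.sum _ fun p hp => ?_
  rw [Finset.HasAntidiagonal.mem_antidiagonal] at hp
  have := (((hda p.1 (by omega)).mul (heb p.2 (by omega)))).mul
    (isIntegral_algebraMap (R := ℤ) (A := Qbar) (x := (w p : ℤ)))
  convert this using 1
  push_cast
  ring

theorem conjugatesGrowAtMostExp_ratCast {q : ℕ → ℚ} {A B : ℝ} (hA : 0 ≤ A) (hB : 0 ≤ B)
    (h : ∀ n, |(q n : ℝ)| ≤ A * B ^ n) : ConjugatesGrowAtMostExp fun n => (q n : Qbar) := by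
  refine conjugatesGrowAtMostExp_of_le hA hB fun σ n => ?_
  have h1 : ((σ (q n : Qbar) : Qbar) : ℂ) = ((q n : ℝ) : ℂ) := by
    rw [map_ratCast]
    norm_cast
  rw [h1, Complex.norm_real, Real.norm_eq_abs]
  exact h n

theorem denominatorsGrowAtMostExp_ratCast {q : ℕ → ℚ} (d : ℕ → ℕ) (D : ℕ) (hD : 0 < D)
    (hd : ∀ n, 0 < d n ∧ d n ≤ D ^ (n + 1))
    (h : ∀ n, ∀ k ≤ n, ∃ z : ℤ, (d n : ℚ) * q k = z) :
    DenominatorsGrowAtMostExp fun n => (q n : Qbar) := by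
  refine ⟨D, hD, fun n => ⟨d n, (hd n).1, (hd n).2, fun k hk => ?_⟩⟩
  obtain ⟨z, hz⟩ := h n k hk
  have h1 : (d n : Qbar) * (q k : Qbar) = (z : Qbar) := by
    exact_mod_cast congrArg (Rat.cast (K := Qbar)) hz
  rw [h1]
  exact isIntegral_algebraMap (R := ℤ) (A := Qbar) (x := z)

theorem exists_norm_conjugates_le (x : Qbar) :
    ∃ M : ℝ, 0 ≤ M ∧ ∀ σ : Qbar ≃ₐ[ℚ] Qbar, ‖((σ x : Qbar) : ℂ)‖ ≤ M := by
  have hx : IsIntegral ℚ x := (algebraicClosure.isAlgebraic ℚ ℂ).isIntegral.isIntegral x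
  have hfin : ((minpoly ℚ x).rootSet Qbar).Finite := Polynomial.rootSet_finite _ _
  obtain ⟨M, hM⟩ := (hfin.image fun y : Qbar => ‖(y : ℂ)‖).bddAbove
  refine ⟨max M 0, le_max_right _ _, fun σ => (hM ⟨σ x, ?_, rfl⟩).trans (le_max_left _ _)⟩
  rw [Polynomial.mem_rootSet]
  refine ⟨minpoly.ne_zero hx, ?_⟩
  have h1 := Polynomial.aeval_algHom_apply (σ : Qbar →ₐ[ℚ] Qbar) x (minpoly ℚ x)
  rw [minpoly.aeval, map_zero] at h1
  exact h1

theorem exists_natCast_mul_isIntegral (x : Qbar) :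
    ∃ d : ℕ, 0 < d ∧ IsIntegral ℤ ((d : Qbar) * x) := by
  have hx : IsAlgebraic ℤ x :=
    (IsFractionRing.isAlgebraic_iff ℤ ℚ Qbar).mpr ((algebraicClosure.isAlgebraic ℚ ℂ).isAlgebraic x)
  obtain ⟨y, hy, hyx⟩ := hx.exists_integral_multiple
  refine ⟨y.natAbs, Int.natAbs_pos.mpr hy, ?_⟩
  rw [zsmul_eq_mul] at hyx
  rcases Int.natAbs_eq y with h | h
  · rwa [h, Int.cast_natCast] at hyx
  · rw [h, Int.cast_neg, Int.cast_natCast, neg_mul] at hyx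
    simpa using hyx.neg

/-- This moves evaluation points to 1 and absorbs algebraic factors and constants. -/
theorem IsEFunction.affine {F : Qbar⟦X⟧} (hF : IsEFunction F) (c ξ b : Qbar) :
    IsEFunction (PowerSeries.C c * PowerSeries.rescale ξ F + PowerSeries.C b) := by
  obtain ⟨hol, ⟨C, hC, hconj⟩, ⟨D, hD, hden⟩⟩ := hF
  have hcoeff : ∀ n : ℕ, (n.factorial : Qbar) * PowerSeries.coeff n
      (PowerSeries.C c * PowerSeries.rescale ξ F + PowerSeries.C b) =
      c * ξ ^ n * ((n.factorial : Qbar) * PowerSeries.coeff n F) + if n = 0 then b else 0 := by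
    intro n
    rw [map_add, PowerSeries.coeff_C_mul, PowerSeries.coeff_rescale, PowerSeries.coeff_C]
    split_ifs with h
    · subst h
      simp
    · ring
  simp only [IsEFunction, hcoeff]
  refine ⟨hol.affine c ξ b, ?_, ?_⟩
  · obtain ⟨Mc, hMc, hc⟩ := exists_norm_conjugates_le c
    obtain ⟨Mξ, hMξ, hξ⟩ := exists_norm_conjugates_le ξ
    obtain ⟨Mb, hMb, hb⟩ := exists_norm_conjugates_le b
    refine conjugatesGrowAtMostExp_of_le (A := Mc * C + Mb) (B := 1 + Mξ * C) (by positivity)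
      (by positivity) fun σ n => ?_
    have h1 : ‖((σ (if n = 0 then b else 0) : Qbar) : ℂ)‖ ≤ Mb * (1 + Mξ * C) ^ n := by
      split_ifs with h
      · subst h
        simpa using hb σ
      · rw [map_zero]
        simp only [ZeroMemClass.coe_zero, norm_zero]
        positivity
    rw [map_add, map_mul, map_mul, map_pow]
    push_cast
    refine (norm_add_le _ _).trans ?_
    rw [add_mul]
    refine add_le_add ?_ h1
    rw [norm_mul, norm_mul, norm_pow]
    have hconj' := hconj σ n
    push_cast at hconj'
    calc ‖((σ c : Qbar) : ℂ)‖ * ‖((σ ξ : Qbar) : ℂ)‖ ^ n * _ ≤ Mc * Mξ ^ n * C ^ (n + 1) := by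
          gcongr
          · exact hc σ
          · exact hξ σ
      _ = Mc * C * (Mξ * C) ^ n := by ring
      _ ≤ Mc * C * (1 + Mξ * C) ^ n := by
          gcongr
          linarith
  · obtain ⟨dc, hdc, hc⟩ := exists_natCast_mul_isIntegral c
    obtain ⟨dξ, hdξ, hξ⟩ := exists_natCast_mul_isIntegral ξ
    obtain ⟨db, hdb, hb⟩ := exists_natCast_mul_isIntegral b
    have hnat : ∀ m : ℕ, IsIntegral ℤ (m : Qbar) := fun m => by
      simpa using isIntegral_algebraMap (R := ℤ) (A := Qbar) (x := (m : ℤ))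
    refine ⟨dc * dξ * db * D, by positivity, fun n => ?_⟩
    obtain ⟨d, hd, hdD, hint⟩ := hden n
    refine ⟨dc * dξ ^ n * db * d, by positivity, ?_, fun k hk => ?_⟩
    · simp only [mul_pow]
      gcongr
      · exact Nat.le_self_pow (by simp) _
      · exact Nat.le_succ n
      · exact Nat.le_self_pow (by simp) _
    · obtain ⟨j, rfl⟩ := Nat.exists_eq_add_of_le hk
      rw [mul_add]
      refine IsIntegral.add ?_ ?_
      · have := ((hc.mul (hξ.pow k)).mul (hint k hk)).mul ((hnat db).mul ((hnat dξ).pow j))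
        convert this using 1
        push_cast
        ring
      · split_ifs with h
        · have := hb.mul (hnat (dc * dξ ^ (k + j) * d))
          convert this using 1
          push_cast
          ring
        · rw [mul_zero]
          exact isIntegral_zero

/-! ### Denominators of binomial coefficients and of the logarithm -/

/-- The logarithm of lcm(1, ..., n) is Chebyshev's ψ(n), which is linearly bounded. -/
theorem exists_lcmUpto_le_pow : ∃ D : ℕ, 0 < D ∧ ∀ n, Nat.lcmUpto n ≤ D ^ n := by
  refine ⟨⌈Real.exp (Real.log 4 + 4)⌉₊, Nat.ceil_pos.mpr (Real.exp_pos _), fun n => ?_⟩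
  have h1 := Chebyshev.psi_le_const_mul_self (Nat.cast_nonneg (α := ℝ) n)
  rw [Chebyshev.psi_eq_log_lcmUpto, Real.log_le_iff_le_exp
    (by exact_mod_cast Nat.lcmUpto_pos n), mul_comm, Real.exp_nat_mul] at h1
  have h2 : (Nat.lcmUpto n : ℝ) ≤ (⌈Real.exp (Real.log 4 + 4)⌉₊ : ℝ) ^ n :=
    h1.trans (by gcongr; exact Nat.le_ceil _)
  exact_mod_cast h2

theorem dvd_lcmUpto {k n : ℕ} (hk : 1 ≤ k) (hkn : k ≤ n) : k ∣ Nat.lcmUpto n :=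
  Finset.dvd_lcm (f := id) (Finset.mem_Icc.mpr ⟨hk, hkn⟩)

theorem factorial_mul_choose_eq_prod {R : Type*} [CommRing R] [BinomialRing R] (r : R) (n : ℕ) :
    (n.factorial : R) * Ring.choose r n = ∏ i ∈ Finset.range n, (r - i) := by
  rw [← nsmul_eq_mul, ← Ring.descPochhammer_eq_factorial_smul_choose]
  induction n with
  | zero => simp
  | succ n ih =>
    rw [descPochhammer_succ_right, Polynomial.smeval_mul, ih, Finset.prod_range_succ,
      Polynomial.smeval_sub, Polynomial.smeval_X, Polynomial.smeval_natCast]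
    simp

/-- Test each prime power l^v dividing n!. If l divides q, then v ≤ n and l^v divides q^n. Otherwise
q has an inverse x modulo l^v, and x^n times the product is congruent to the product of the p x - i,
which is n! times an integer binomial coefficient. -/
theorem factorial_dvd_pow_mul_prod (p : ℤ) (q n : ℕ) :
    (n.factorial : ℤ) ∣ (q : ℤ) ^ n * ∏ i ∈ Finset.range n, (p - i * q) := by
  rw [← Int.natAbs_dvd_natAbs, Int.natAbs_natCast, Nat.dvd_iff_prime_pow_dvd_dvd]
  intro l v hl hv
  rw [← Int.natCast_dvd]
  by_cases hlq : l ∣ q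
  · have : Fact l.Prime := ⟨hl⟩
    have hvn : v ≤ n := ((padicValNat_dvd_iff_le n.factorial_ne_zero).mp hv).trans
      (padicValNat_factorial_le l n)
    refine Dvd.dvd.mul_right ?_ _
    exact_mod_cast (pow_dvd_pow l hvn).trans (pow_dvd_pow_of_dvd hlq n)
  · have hco : IsCoprime (q : ℤ) ((l ^ v : ℕ) : ℤ) :=
      Nat.isCoprime_iff_coprime.mpr (((Nat.Prime.coprime_iff_not_dvd hl).mpr hlq).symm.pow_right v)
    obtain ⟨x, y, hxy⟩ := hco
    refine Dvd.dvd.mul_left ?_ _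
    have hcx : IsCoprime ((l ^ v : ℕ) : ℤ) (x ^ n) :=
      IsCoprime.pow_right ⟨y, q, by linear_combination hxy⟩
    refine hcx.dvd_of_dvd_mul_left ?_
    have h1 : x ^ n * ∏ i ∈ Finset.range n, (p - i * q) ≡
        ∏ i ∈ Finset.range n, (p * x - i) [ZMOD ((l ^ v : ℕ) : ℤ)] := by
      have : x ^ n = ∏ i ∈ Finset.range n, x := by simp
      rw [this, ← Finset.prod_mul_distrib]
      refine Int.ModEq.prod fun i _ => ?_
      rw [Int.modEq_iff_dvd]
      exact ⟨- i * y, by linear_combination (i : ℤ) * hxy⟩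
    rw [← factorial_mul_choose_eq_prod] at h1
    exact h1.dvd_iff.mpr (Dvd.dvd.mul_right (by exact_mod_cast hv) _)

/-- One n-th power of the denominator makes the factors α - i integral; the other allows division by
n!. -/
theorem exists_int_eq_den_pow_mul_choose (α : ℚ) (n : ℕ) :
    ∃ z : ℤ, (α.den : ℚ) ^ (2 * n) * Ring.choose α n = z := by
  obtain ⟨z, hz⟩ := factorial_dvd_pow_mul_prod α.num α.den n
  refine ⟨z, ?_⟩
  have hf : (n.factorial : ℚ) ≠ 0 := by exact_mod_cast n.factorial_ne_zero
  have h1 := factorial_mul_choose_eq_prod α n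
  have h2 : (α.den : ℚ) ^ n * ∏ i ∈ Finset.range n, (α - i) =
      ∏ i ∈ Finset.range n, ((α.num : ℚ) - i * α.den) := by
    have : (α.den : ℚ) ^ n = ∏ i ∈ Finset.range n, (α.den : ℚ) := by simp
    rw [this, ← Finset.prod_mul_distrib]
    refine Finset.prod_congr rfl fun i _ => ?_
    have := Rat.mul_den_eq_num α
    linear_combination this
  have h3 := congrArg (Int.cast (R := ℚ)) hz
  push_cast at h3
  apply mul_left_cancel₀ hf
  rw [← h3, ← h2, ← h1]
  ring

theorem abs_choose_le (α : ℚ) (n : ℕ) : |((Ring.choose α n : ℚ) : ℝ)| ≤ 1 * (1 + |(α : ℝ)|) ^ n := by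
  rw [one_mul]
  have hf : (0 : ℝ) < n.factorial := by exact_mod_cast n.factorial_pos
  have h1 := congrArg (fun x : ℚ => |(x : ℝ)|) (factorial_mul_choose_eq_prod α n)
  push_cast at h1
  rw [abs_mul, Finset.abs_prod, Nat.abs_cast] at h1
  refine le_of_mul_le_mul_left ?_ hf
  rw [h1, mul_comm, ← Finset.prod_range_add_one_eq_factorial]
  push_cast
  have : (1 + |(α : ℝ)|) ^ n = ∏ i ∈ Finset.range n, (1 + |(α : ℝ)|) := by simp
  rw [this, ← Finset.prod_mul_distrib]
  -- Factor by factor, |α - i| ≤ (i + 1)(1 + |α|).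
  refine Finset.prod_le_prod (fun _ _ => abs_nonneg _) fun i _ => ?_
  have h2 := abs_sub (α : ℝ) i
  rw [Nat.abs_cast] at h2
  have h3 := abs_nonneg (α : ℝ)
  have h4 : (0 : ℝ) ≤ i := Nat.cast_nonneg i
  nlinarith [mul_nonneg h3 h4]

theorem conjugatesGrowAtMostExp_binomialSeries (α : ℚ) :
    ConjugatesGrowAtMostExp fun n => PowerSeries.coeff n (PowerSeries.binomialSeries Qbar α) := by
  simp only [PowerSeries.binomialSeries_coeff, Rat.smul_one_eq_cast]
  exact conjugatesGrowAtMostExp_ratCast zero_le_one (by positivity) (abs_choose_le α)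

theorem denominatorsGrowAtMostExp_binomialSeries (α : ℚ) :
    DenominatorsGrowAtMostExp fun n => PowerSeries.coeff n (PowerSeries.binomialSeries Qbar α) := by
  simp only [PowerSeries.binomialSeries_coeff, Rat.smul_one_eq_cast]
  refine denominatorsGrowAtMostExp_ratCast (fun n => α.den ^ (2 * n)) (α.den ^ 2)
    (pow_pos α.den_pos _) (fun n => ⟨pow_pos α.den_pos _, ?_⟩) fun n k hk => ?_
  · rw [← pow_mul]
    exact Nat.pow_le_pow_right α.den_pos (by omega)
  · obtain ⟨j, rfl⟩ := Nat.exists_eq_add_of_le hk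
    obtain ⟨z, hz⟩ := exists_int_eq_den_pow_mul_choose α k
    refine ⟨α.den ^ (2 * j) * z, ?_⟩
    push_cast
    rw [← hz]
    ring

theorem coeff_log_eq_ratCast (n : ℕ) : PowerSeries.coeff n (PowerSeries.log Qbar) =
    ((if n = 0 then 0 else (-1 : ℚ) ^ (n + 1) / n : ℚ) : Qbar) := by
  rw [PowerSeries.coeff_log]
  split_ifs <;> simp

theorem conjugatesGrowAtMostExp_log :
    ConjugatesGrowAtMostExp fun n => PowerSeries.coeff n (PowerSeries.log Qbar) := by
  simp only [coeff_log_eq_ratCast]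
  refine conjugatesGrowAtMostExp_ratCast (A := 1) (B := 1) zero_le_one zero_le_one fun n => ?_
  split_ifs with h
  · simp
  · have : (1 : ℝ) ≤ n := by exact_mod_cast Nat.one_le_iff_ne_zero.mpr h
    push_cast
    rw [abs_div, abs_pow, abs_neg, abs_one, one_pow, one_pow, mul_one, Nat.abs_cast]
    exact div_le_one_of_le₀ this (by positivity)

theorem denominatorsGrowAtMostExp_log :
    DenominatorsGrowAtMostExp fun n => PowerSeries.coeff n (PowerSeries.log Qbar) := by
  simp only [coeff_log_eq_ratCast]
  obtain ⟨D, hD, hlcm⟩ := exists_lcmUpto_le_pow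
  refine denominatorsGrowAtMostExp_ratCast Nat.lcmUpto D hD
    (fun n => ⟨Nat.lcmUpto_pos n, (hlcm n).trans (Nat.pow_le_pow_right hD (by omega))⟩)
    fun n k hk => ?_
  split_ifs with h
  · exact ⟨0, by simp⟩
  · obtain ⟨m, hm⟩ := dvd_lcmUpto (Nat.one_le_iff_ne_zero.mpr h) hk
    refine ⟨m * (-1) ^ (k + 1), ?_⟩
    have : (k : ℚ) ≠ 0 := by exact_mod_cast h
    rw [hm]
    push_cast
    field_simp

theorem ConjugatesGrowAtMostExp.coeff_mul {F G : Qbar⟦X⟧}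
    (hF : ConjugatesGrowAtMostExp fun n => PowerSeries.coeff n F)
    (hG : ConjugatesGrowAtMostExp fun n => PowerSeries.coeff n G) :
    ConjugatesGrowAtMostExp fun n => PowerSeries.coeff n (F * G) :=
  hF.convolution (w := fun _ => 1) hG (fun _ => Nat.one_le_two_pow) fun n => by
    simp [PowerSeries.coeff_mul]

theorem DenominatorsGrowAtMostExp.coeff_mul {F G : Qbar⟦X⟧}
    (hF : DenominatorsGrowAtMostExp fun n => PowerSeries.coeff n F)
    (hG : DenominatorsGrowAtMostExp fun n => PowerSeries.coeff n G) :
    DenominatorsGrowAtMostExp fun n => PowerSeries.coeff n (F * G) :=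
  hF.convolution (w := fun _ => 1) hG fun n => by
    simp [PowerSeries.coeff_mul]

theorem factorial_mul_coeff_mul (F G : Qbar⟦X⟧) (n : ℕ) :
    (n.factorial : Qbar) * PowerSeries.coeff n (F * G) =
      ∑ p ∈ Finset.HasAntidiagonal.antidiagonal n, (((p.1 + p.2).choose p.2 : ℕ) : Qbar) *
        ((p.1.factorial * PowerSeries.coeff p.1 F) *
          (p.2.factorial * PowerSeries.coeff p.2 G)) := by
  rw [PowerSeries.coeff_mul, Finset.mul_sum]
  refine Finset.sum_congr rfl fun p hp => ?_
  rw [Finset.HasAntidiagonal.mem_antidiagonal] at hp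
  have := congrArg (Nat.cast (R := Qbar)) (Nat.add_choose_mul_factorial_mul_factorial p.1 p.2)
  rw [← hp, ← this]
  push_cast
  ring

theorem ConjugatesGrowAtMostExp.factorial_mul_coeff_mul {F G : Qbar⟦X⟧}
    (hF : ConjugatesGrowAtMostExp fun n => (n.factorial : Qbar) * PowerSeries.coeff n F)
    (hG : ConjugatesGrowAtMostExp fun n => (n.factorial : Qbar) * PowerSeries.coeff n G) :
    ConjugatesGrowAtMostExp fun n => (n.factorial : Qbar) * PowerSeries.coeff n (F * G) :=
  hF.convolution (w := fun p => (p.1 + p.2).choose p.2) hG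
    (fun p => Nat.choose_le_two_pow (p.1 + p.2) p.2)
    (_root_.factorial_mul_coeff_mul F G)

theorem DenominatorsGrowAtMostExp.factorial_mul_coeff_mul {F G : Qbar⟦X⟧}
    (hF : DenominatorsGrowAtMostExp fun n => (n.factorial : Qbar) * PowerSeries.coeff n F)
    (hG : DenominatorsGrowAtMostExp fun n => (n.factorial : Qbar) * PowerSeries.coeff n G) :
    DenominatorsGrowAtMostExp fun n => (n.factorial : Qbar) * PowerSeries.coeff n (F * G) :=
  hF.convolution (w := fun p => (p.1 + p.2).choose p.2) hG (_root_.factorial_mul_coeff_mul F G)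

theorem conjugatesGrowAtMostExp_binomialLogSeries (α : ℚ) (s : ℕ) :
    ConjugatesGrowAtMostExp fun n => PowerSeries.coeff n (binomialLogSeries α s) := by
  induction s with
  | zero => simpa [binomialLogSeries] using conjugatesGrowAtMostExp_binomialSeries α
  | succ s ih =>
    have : binomialLogSeries α (s + 1) = binomialLogSeries α s * PowerSeries.log Qbar := by
      rw [binomialLogSeries, binomialLogSeries, pow_succ, mul_assoc]
    rw [this]
    exact ih.coeff_mul conjugatesGrowAtMostExp_log

theorem denominatorsGrowAtMostExp_binomialLogSeries (α : ℚ) (s : ℕ) :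
    DenominatorsGrowAtMostExp fun n => PowerSeries.coeff n (binomialLogSeries α s) := by
  induction s with
  | zero => simpa [binomialLogSeries] using denominatorsGrowAtMostExp_binomialSeries α
  | succ s ih =>
    have : binomialLogSeries α (s + 1) = binomialLogSeries α s * PowerSeries.log Qbar := by
      rw [binomialLogSeries, binomialLogSeries, pow_succ, mul_assoc]
    rw [this]
    exact ih.coeff_mul denominatorsGrowAtMostExp_log

theorem factorial_mul_coeff_borelTransform (F : Qbar⟦X⟧) (n : ℕ) :
    (n.factorial : Qbar) * PowerSeries.coeff n (borelTransform F) = PowerSeries.coeff n F := by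
  have hf : (n.factorial : Qbar) ≠ 0 := by exact_mod_cast n.factorial_ne_zero
  rw [borelTransform, PowerSeries.coeff_mk, mul_div_cancel₀ _ hf]

theorem isGFunction_binomialLogSeries (α : ℚ) (s : ℕ) : IsGFunction (binomialLogSeries α s) := by
  change IsEFunction (borelTransform _)
  refine ⟨isHolonomic_borelTransform_binomialLogSeries α s, ?_, ?_⟩
  · simpa only [factorial_mul_coeff_borelTransform] using
      conjugatesGrowAtMostExp_binomialLogSeries α s
  · simpa only [factorial_mul_coeff_borelTransform] using
      denominatorsGrowAtMostExp_binomialLogSeries α s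

theorem borelTransform_seriesAntie (a : ℚ) (s : ℕ) :
    borelTransform (seriesAntie a s) = binomialLogSeries (a - 1) s := by
  ext n : 1
  have hf : (n.factorial : Qbar) ≠ 0 := by exact_mod_cast n.factorial_ne_zero
  rw [borelTransform, PowerSeries.coeff_mk, seriesAntie, PowerSeries.coeff_mk,
    mul_div_cancel_left₀ _ hf, binomialLogSeries]

theorem isAntieFunction_seriesAntie (a : ℚ) (s : ℕ) : IsAntieFunction (seriesAntie a s) := by
  rw [IsAntieFunction, borelTransform_seriesAntie]
  exact isGFunction_binomialLogSeries _ _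

/-! ### The E-functions `seriesE` and e^(-z) `seriesE` -/

theorem factorial_mul_coeff_seriesE (a : ℚ) (s n : ℕ) :
    (n.factorial : Qbar) * PowerSeries.coeff n (seriesE a s) =
      ((1 / ((n : ℚ) + a) ^ s : ℚ) : Qbar) := by
  have hf : (n.factorial : Qbar) ≠ 0 := by exact_mod_cast n.factorial_ne_zero
  rw [seriesE, PowerSeries.coeff_mk, one_div, mul_inv, ← mul_assoc, mul_inv_cancel₀ hf]
  push_cast
  simp

theorem conjugatesGrowAtMostExp_seriesE {a : ℚ} (ha : 0 < a) (s : ℕ) :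
    ConjugatesGrowAtMostExp fun n => (n.factorial : Qbar) * PowerSeries.coeff n (seriesE a s) := by
  simp only [factorial_mul_coeff_seriesE]
  have ha' : (0 : ℝ) < a := by exact_mod_cast ha
  refine conjugatesGrowAtMostExp_ratCast (A := 1 / (a : ℝ) ^ s) (B := 1) (by positivity)
    zero_le_one fun n => ?_
  push_cast
  rw [abs_of_nonneg (by positivity), one_pow, mul_one]
  gcongr
  linarith [Nat.cast_nonneg (α := ℝ) n]

theorem denominatorsGrowAtMostExp_seriesE {a : ℚ} (ha : 0 < a) (s : ℕ) :
    DenominatorsGrowAtMostExp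
      fun n => (n.factorial : Qbar) * PowerSeries.coeff n (seriesE a s) := by
  simp only [factorial_mul_coeff_seriesE]
  obtain ⟨D, hD, hlcm⟩ := exists_lcmUpto_le_pow
  set q := a.den with hq
  set p := a.num.toNat with hp
  have hp0 : 0 < p := by
    have := Rat.num_pos.mpr ha
    omega
  have hpa : (q : ℚ) * a = p := by
    have h1 : ((p : ℤ) : ℚ) = a.num := by
      rw [hp, Int.toNat_of_nonneg (Rat.num_nonneg.mpr ha.le)]
    rw [Int.cast_natCast] at h1
    rw [h1, mul_comm, hq, Rat.mul_den_eq_num]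
  have hq0 : 0 < q := a.den_pos
  -- With a = p/q, one has k + a = (qk + p)/q, and qk + p divides lcm(1, ..., qn + p) for k ≤ n.
  refine denominatorsGrowAtMostExp_ratCast (fun n => Nat.lcmUpto (q * n + p) ^ s)
    (D ^ ((q + p) * s)) (by positivity)
    (fun n => ⟨pow_pos (Nat.lcmUpto_pos _) _, ?_⟩) fun n k hk => ?_
  · calc Nat.lcmUpto (q * n + p) ^ s ≤ (D ^ (q * n + p)) ^ s := by gcongr; exact hlcm _
      _ ≤ (D ^ ((q + p) * (n + 1))) ^ s := by
          gcongr
          nlinarith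
      _ = (D ^ ((q + p) * s)) ^ (n + 1) := by
          rw [← pow_mul, ← pow_mul]
          ring_nf
  · obtain ⟨m, hm⟩ := dvd_lcmUpto (k := q * k + p) (n := q * n + p) (by omega) (by gcongr)
    refine ⟨(m * q) ^ s, ?_⟩
    have h0 : (k : ℚ) + a ≠ 0 := by positivity
    rw [hm]
    push_cast
    rw [← hpa, ← mul_add, one_div, mul_pow, mul_pow, mul_pow]
    field_simp

theorem isEFunction_seriesE {a : ℚ} (ha : 0 < a) (s : ℕ) : IsEFunction (seriesE a s) := by
  refine ⟨?_, conjugatesGrowAtMostExp_seriesE ha s, denominatorsGrowAtMostExp_seriesE ha s⟩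
  have := isHolonomic_mul_seriesE ha s (W := 1) (β := 0) (by simp)
  rwa [one_mul] at this

/-- The power series of `exp (-z)`. -/
noncomputable def expNegSeries : Qbar⟦X⟧ :=
  PowerSeries.rescale (-1) (PowerSeries.exp Qbar)

theorem factorial_mul_coeff_expNegSeries (n : ℕ) :
    (n.factorial : Qbar) * PowerSeries.coeff n expNegSeries = (((-1) ^ n : ℚ) : Qbar) := by
  have hf : (n.factorial : Qbar) ≠ 0 := by exact_mod_cast n.factorial_ne_zero
  rw [expNegSeries, PowerSeries.coeff_rescale, PowerSeries.coeff_exp]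
  push_cast
  rw [one_div, mul_comm, mul_assoc, inv_mul_cancel₀ hf, mul_one]

/-- At -1 the factor e^(-z) equals e, which compensates the e^(-1) in front of the set of mixed
values. -/
theorem isEFunction_expNegSeries_mul_seriesE {a : ℚ} (ha : 0 < a) (s : ℕ) :
    IsEFunction (expNegSeries * seriesE a s) := by
  refine ⟨isHolonomic_mul_seriesE ha s (β := -1) ?_,
    ConjugatesGrowAtMostExp.factorial_mul_coeff_mul ?_ (conjugatesGrowAtMostExp_seriesE ha s),
    DenominatorsGrowAtMostExp.factorial_mul_coeff_mul ?_ (denominatorsGrowAtMostExp_seriesE ha s)⟩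
  · rw [expNegSeries, derivative_rescale, PowerSeries.derivative_exp]
  · simp only [factorial_mul_coeff_expNegSeries]
    exact conjugatesGrowAtMostExp_ratCast (A := 1) (B := 1) zero_le_one zero_le_one
      fun n => by simp
  · simp only [factorial_mul_coeff_expNegSeries]
    exact denominatorsGrowAtMostExp_ratCast (fun _ => 1) 1 one_pos (fun n => by simp)
      fun n k _ => ⟨(-1) ^ k, by simp⟩

/-! ### Values of convergent series -/

theorem hasValueAt_of_hasSum {F : Qbar⟦X⟧} {z u : ℂ} {f : ℕ → ℂ} (h : HasSum f u)
    (hf : ∀ n, ((PowerSeries.coeff n F : Qbar) : ℂ) * z ^ n = f n) : HasValueAt F z u := by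
  obtain rfl : (fun n => ((PowerSeries.coeff n F : Qbar) : ℂ) * z ^ n) = f := funext hf
  exact h

theorem HasValueAt.mul {F G : Qbar⟦X⟧} {z u v : ℂ} (hF : HasValueAt F z u)
    (hG : HasValueAt G z v) : HasValueAt (F * G) z (u * v) := by
  have hF' := hF.summable.norm
  have hG' := hG.summable.norm
  have h := (summable_norm_sum_mul_antidiagonal_of_summable_norm hF' hG').of_norm.hasSum
  rw [← tsum_mul_tsum_eq_tsum_sum_antidiagonal_of_summable_norm hF' hG', hF.tsum_eq,
    hG.tsum_eq] at h
  refine hasValueAt_of_hasSum h fun n => ?_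
  rw [PowerSeries.coeff_mul]
  push_cast
  rw [Finset.sum_mul]
  refine Finset.sum_congr rfl fun p hp => ?_
  rw [Finset.HasAntidiagonal.mem_antidiagonal] at hp
  rw [← hp, pow_add]
  ring

theorem HasValueAt.add {F G : Qbar⟦X⟧} {z u v : ℂ} (hF : HasValueAt F z u)
    (hG : HasValueAt G z v) : HasValueAt (F + G) z (u + v) := by
  unfold HasValueAt
  convert HasSum.add hF hG using 2 with n
  rw [map_add]
  push_cast
  ring

theorem hasValueAt_C (c : Qbar) (z : ℂ) : HasValueAt (PowerSeries.C c) z c := by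
  unfold HasValueAt
  convert hasSum_single (f := fun n : ℕ => ((PowerSeries.coeff n (PowerSeries.C c) : Qbar) : ℂ)
    * z ^ n) 0 ?_ using 1
  · simp
  · intro n hn
    simp [PowerSeries.coeff_C, hn]

theorem HasValueAt.pow {F : Qbar⟦X⟧} {z u : ℂ} (hF : HasValueAt F z u) (n : ℕ) :
    HasValueAt (F ^ n) z (u ^ n) := by
  induction n with
  | zero => simpa using hasValueAt_C 1 z
  | succ n ih => simpa only [pow_succ] using ih.mul hF

theorem hasValueAt_rescale_iff {F : Qbar⟦X⟧} {ξ : Qbar} {z u : ℂ} :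
    HasValueAt (PowerSeries.rescale ξ F) z u ↔ HasValueAt F (ξ * z) u := by
  unfold HasValueAt
  refine iff_of_eq (congrArg (fun f => HasSum f u _) (funext fun n => ?_))
  rw [PowerSeries.coeff_rescale]
  push_cast
  ring

theorem HasValueAt.affine {F : Qbar⟦X⟧} {ξ : Qbar} {z u : ℂ} (h : HasValueAt F (ξ * z) u)
    (c b : Qbar) :
    HasValueAt (PowerSeries.C c * PowerSeries.rescale ξ F + PowerSeries.C b) z (c * u + b) :=
  ((hasValueAt_C c z).mul (hasValueAt_rescale_iff.mpr h)).add (hasValueAt_C b z)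

theorem hasValueAt_exp (z : ℂ) : HasValueAt (PowerSeries.exp Qbar) z (Complex.exp z) := by
  have h := NormedSpace.expSeries_div_hasSum_exp z
  rw [← Complex.exp_eq_exp_ℂ] at h
  refine hasValueAt_of_hasSum h fun n => ?_
  rw [PowerSeries.coeff_exp]
  simp
  ring

theorem hasValueAt_expNegSeries (z : ℂ) : HasValueAt expNegSeries z (Complex.exp (-z)) := by
  rw [expNegSeries, hasValueAt_rescale_iff]
  convert hasValueAt_exp (-z) using 1
  push_cast
  ring

theorem hasValueAt_binomialSeries (α : ℚ) {x : ℂ} (hx : ‖x‖ < 1) :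
    HasValueAt (PowerSeries.binomialSeries Qbar α) x ((1 + x) ^ (α : ℂ)) := by
  have h := (Complex.one_add_cpow_hasFPowerSeriesOnBall_zero (a := (α : ℂ))).hasSum (y := x)
    (by rwa [Metric.mem_eball, edist_zero_right, ← ofReal_norm, ENNReal.ofReal_lt_one])
  rw [zero_add] at h
  refine hasValueAt_of_hasSum h fun n => ?_
  rw [binomialSeries_apply, PowerSeries.binomialSeries_coeff, Rat.smul_one_eq_cast]
  have := Ring.map_choose (Rat.castHom ℂ) α n
  simp only [Rat.coe_castHom] at this
  rw [← this]
  simp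

theorem hasValueAt_log {x : ℂ} (hx : ‖x‖ < 1) :
    HasValueAt (PowerSeries.log Qbar) x (Complex.log (1 + x)) := by
  unfold HasValueAt
  convert Complex.hasSum_taylorSeries_log hx using 2 with n
  rw [coeff_log_eq_ratCast]
  split_ifs with h
  · simp [h]
  · push_cast
    ring

theorem hasValueAt_binomialLogSeries (α : ℚ) (s : ℕ) {x : ℂ} (hx : ‖x‖ < 1) :
    HasValueAt (binomialLogSeries α s) x ((1 + x) ^ (α : ℂ) * Complex.log (1 + x) ^ s) :=
  (hasValueAt_binomialSeries α hx).mul ((hasValueAt_log hx).pow s)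

/-! ### Borel continuation and 1-sum of `seriesAntie` -/

theorem re_pos_of_mem_sectorAround {ε : ℝ} (hε : ε ≤ Real.pi / 2) {x : ℂ}
    (hx : x ∈ sectorAround 0 ε) : 0 < x.re := by
  obtain ⟨h0, harg⟩ := hx
  simp only [Complex.ofReal_zero, zero_mul, Complex.exp_zero, mul_one] at harg
  exact (Complex.abs_arg_lt_pi_div_two_iff.mp (harg.trans_le hε)).resolve_right h0

theorem one_add_pow_le_mul_exp {K t : ℝ} (hK : 0 < K) (ht : 0 ≤ t) (m : ℕ) :
    (1 + t) ^ m ≤ (m.factorial / K ^ m * Real.exp K) * Real.exp (K * t) := by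
  have h := Real.pow_div_factorial_le_exp (K * (1 + t)) (by positivity) m
  rw [mul_add, mul_one, Real.exp_add, div_le_iff₀ (by positivity), ← mul_one_add, mul_pow] at h
  rw [div_mul_eq_mul_div, div_mul_eq_mul_div, le_div_iff₀ (by positivity)]
  linarith

theorem norm_log_le_of_one_le_norm {y : ℂ} (hy : 1 ≤ ‖y‖) :
    ‖Complex.log y‖ ≤ (1 + Real.pi) * ‖y‖ := by
  refine (Complex.norm_le_abs_re_add_abs_im _).trans ?_
  rw [Complex.log_re, Complex.log_im, abs_of_nonneg (Real.log_nonneg hy)]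
  have h1 := Real.log_le_self (by positivity : 0 ≤ ‖y‖)
  have h2 := Complex.abs_arg_le_pi y
  nlinarith [Real.pi_pos]

theorem norm_cpow_ratCast_le {y : ℂ} (hy : 1 ≤ ‖y‖) (α : ℚ) :
    ‖y ^ (α : ℂ)‖ ≤ ‖y‖ ^ ⌈|(α : ℝ)|⌉₊ := by
  have hy0 : y ≠ 0 := norm_pos_iff.mp (by linarith)
  rw [Complex.norm_cpow_of_ne_zero hy0, Complex.ratCast_re, Complex.ratCast_im, mul_zero,
    Real.exp_zero, div_one, ← Real.rpow_natCast]
  exact Real.rpow_le_rpow_of_exponent_le hy ((le_abs_self _).trans (Nat.le_ceil _))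

theorem isBorelContinuation_seriesAntie (a : ℚ) (s : ℕ) :
    IsBorelContinuation (seriesAntie a s) 0
      fun x => (1 + x) ^ ((a - 1 : ℚ) : ℂ) * Complex.log (1 + x) ^ s := by
  have hhalf : (1 / 2 : ℝ) ≤ Real.pi / 2 := by linarith [Real.pi_gt_three]
  -- As 1/2 is below both 1 and π/2, the disc lies in the unit disc and the sector in the right
  -- half-plane, so 1 + x avoids the cut of the logarithm.
  refine ⟨1 / 2, by norm_num, ?_, ?_, ?_⟩
  · intro x hx
    have hslit : 1 + x ∈ Complex.slitPlane := by
      rcases hx with hx | hx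
      · exact Complex.mem_slitPlane_of_norm_lt_one
          ((mem_ball_zero_iff.mp hx).trans (by norm_num))
      · refine Or.inl ?_
        have := re_pos_of_mem_sectorAround hhalf hx
        rw [Complex.add_re, Complex.one_re]
        linarith
    have h1 : DifferentiableAt ℂ (fun x : ℂ => 1 + x) x := by fun_prop
    exact ((h1.cpow (differentiableAt_const _) hslit).mul
      ((h1.clog hslit).pow s)).differentiableWithinAt
  · intro x hx
    rw [borelTransform_seriesAntie]
    exact hasValueAt_binomialLogSeries _ _ ((mem_ball_zero_iff.mp hx).trans (by norm_num))
  · intro K hK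
    -- In the sector |1 + x| ≥ 1, so the power is at most |1 + x|^m and each logarithm costs one
    -- more degree; a polynomial bound of degree m + s is below any exponential e^(K|x|) up to a
    -- constant.
    set m := ⌈|((a - 1 : ℚ) : ℝ)|⌉₊ with hm
    refine ⟨(1 + Real.pi) ^ s * ((m + s).factorial / K ^ (m + s) * Real.exp K), fun x hx => ?_⟩
    have hre := re_pos_of_mem_sectorAround hhalf hx
    have hy : 1 ≤ ‖1 + x‖ := by
      have := Complex.re_le_norm (1 + x)
      rw [Complex.add_re, Complex.one_re] at this
      linarith
    have hy' : ‖1 + x‖ ≤ 1 + ‖x‖ := by simpa using norm_add_le 1 x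
    have hpi := Real.pi_pos
    rw [norm_mul, norm_pow]
    calc ‖(1 + x) ^ ((a - 1 : ℚ) : ℂ)‖ * ‖Complex.log (1 + x)‖ ^ s
        ≤ ‖1 + x‖ ^ m * ((1 + Real.pi) * ‖1 + x‖) ^ s := by
          gcongr
          · exact norm_cpow_ratCast_le hy _
          · exact norm_log_le_of_one_le_norm hy
      _ = (1 + Real.pi) ^ s * ‖1 + x‖ ^ (m + s) := by rw [mul_pow, pow_add]; ring
      _ ≤ (1 + Real.pi) ^ s * (1 + ‖x‖) ^ (m + s) := by gcongr
      _ ≤ (1 + Real.pi) ^ s * (((m + s).factorial / K ^ (m + s) * Real.exp K) *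
            Real.exp (K * ‖x‖)) := by
          gcongr
          exact one_add_pow_le_mul_exp hK (norm_nonneg x) _
      _ = _ := by ring

theorem hasOneSumAt_seriesAntie (a : ℚ) (s : ℕ) :
    HasOneSumAt (seriesAntie a s) 0 1 ((∫ t in Set.Ioi (0 : ℝ),
      (1 + t) ^ ((a : ℝ) - 1) * Real.log (1 + t) ^ s * Real.exp (-t) : ℝ) : ℂ) := by
  refine ⟨by simp, _, isBorelContinuation_seriesAntie a s, ?_⟩
  rw [one_mul, ← integral_complex_ofReal]
  refine MeasureTheory.setIntegral_congr_fun measurableSet_Ioi fun t ht => ?_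
  have ht' : (0 : ℝ) ≤ 1 + t := by linarith [Set.mem_Ioi.mp ht]
  simp only [Complex.ofReal_zero, zero_mul, neg_zero, Complex.exp_zero, mul_one]
  push_cast
  rw [Complex.ofReal_cpow ht', Complex.ofReal_log ht']
  push_cast
  rfl

/-! ### Adding a constant to a Gevrey series -/

theorem borelTransform_C (c : Qbar) : borelTransform (PowerSeries.C c) = PowerSeries.C c := by
  ext n : 1
  rw [borelTransform, PowerSeries.coeff_mk, PowerSeries.coeff_C]
  split_ifs with h
  · simp [h]
  · simp

theorem IsBorelContinuation.add_C {f : Qbar⟦X⟧} {θ : ℝ} {B : ℂ → ℂ}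
    (h : IsBorelContinuation f θ B) (c : Qbar) :
    IsBorelContinuation (f + PowerSeries.C c) θ fun x => B x + c := by
  obtain ⟨ε, hε, hd, hv, hg⟩ := h
  refine ⟨ε, hε, hd.add_const _, fun x hx => ?_, fun K hK => ?_⟩
  · rw [borelTransform_add, borelTransform_C]
    exact (hv x hx).add (hasValueAt_C c x)
  · obtain ⟨C, hC⟩ := hg K hK
    refine ⟨C + ‖(c : ℂ)‖, fun x hx => (norm_add_le _ _).trans ?_⟩
    rw [add_mul]
    refine add_le_add (hC x hx) (le_mul_of_one_le_right (norm_nonneg _) ?_)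
    exact Real.one_le_exp (by positivity)

theorem isAntiStokes_add_C_iff {f : Qbar⟦X⟧} {θ : ℝ} (c : Qbar) :
    IsAntiStokes (f + PowerSeries.C c) θ ↔ IsAntiStokes f θ := by
  unfold IsAntiStokes
  refine not_congr ⟨fun ⟨B, hB⟩ => ?_, fun ⟨B, hB⟩ => ⟨_, hB.add_C c⟩⟩
  have := hB.add_C (-c)
  rw [map_neg, add_neg_cancel_right] at this
  exact ⟨_, this⟩

/-- The Laplace integral of a constant c, times z, is c. Splitting the integral requires
integrability of the original integrand, supplied by the growth condition. -/
theorem HasOneSumAt.add_C {f : Qbar⟦X⟧} {θ : ℝ} {z w : ℂ} (h : HasOneSumAt f θ z w) (c : Qbar) :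
    HasOneSumAt (f + PowerSeries.C c) θ z (w + c) := by
  obtain ⟨hre, B, hB, hw⟩ := h
  refine ⟨hre, _, hB.add_C c, ?_⟩
  set e := Complex.exp (-(θ * Complex.I)) with he
  have he0 : e ≠ 0 := Complex.exp_ne_zero _
  have hz0 : z ≠ 0 := by
    rintro rfl
    simp at hre
  have henorm : ‖e‖ = 1 := by
    rw [he, ← neg_mul, ← Complex.ofReal_neg, Complex.norm_exp_ofReal_mul_I]
  have hneg : (-(z * e)).re < 0 := by
    rw [Complex.neg_re]
    linarith
  have hexp : ∀ t : ℝ, Complex.exp (-(t * e * z)) = Complex.exp (-(z * e) * t) := fun t => by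
    congr 1
    ring
  have hray : ∀ t : ℝ, 0 < t → ∀ ε : ℝ, 0 < ε → (t : ℂ) * e ∈ sectorAround θ ε := by
    intro t ht ε hε
    refine ⟨mul_ne_zero (by exact_mod_cast ht.ne') he0, ?_⟩
    rw [mul_assoc, he, ← Complex.exp_add, neg_add_cancel, Complex.exp_zero, mul_one,
      Complex.arg_ofReal_of_nonneg ht.le, abs_zero]
    exact hε
  have hint1 : MeasureTheory.IntegrableOn
      (fun t : ℝ => B (t * e) * Complex.exp (-(t * e * z)) * e) (Set.Ioi 0) := by
    obtain ⟨ε, hε, hd, -, hg⟩ := hB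
    -- Taking half the decay rate of the kernel as growth rate of B leaves an integrable
    -- exponential.
    obtain ⟨C, hC⟩ := hg ((z * e).re / 2) (by linarith)
    have hcont : ContinuousOn (fun t : ℝ => B (t * e) * Complex.exp (-(t * e * z)) * e)
        (Set.Ioi 0) := by
      have h1 : ContinuousOn (fun t : ℝ => B (t * e)) (Set.Ioi 0) :=
        hd.continuousOn.comp (f := fun t : ℝ => (t : ℂ) * e) (by fun_prop)
          fun t ht => Or.inr (hray t ht ε hε)
      exact (h1.mul (by fun_prop)).mul continuousOn_const
    have hb : MeasureTheory.IntegrableOn (fun t : ℝ => C * Real.exp (-((z * e).re / 2) * t))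
        (Set.Ioi 0) := (exp_neg_integrableOn_Ioi 0 (by linarith)).const_mul C
    refine MeasureTheory.Integrable.mono' hb (hcont.aestronglyMeasurable measurableSet_Ioi) ?_
    refine (MeasureTheory.ae_restrict_mem measurableSet_Ioi).mono fun t ht => ?_
    have ht' : 0 < t := ht
    have hCt := hC _ (hray t ht' ε hε)
    rw [norm_mul, henorm, mul_one, Complex.norm_real, Real.norm_eq_abs, abs_of_pos ht'] at hCt
    rw [norm_mul, norm_mul, henorm, mul_one, hexp, Complex.norm_exp, Complex.re_mul_ofReal,
      Complex.neg_re]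
    calc ‖B (t * e)‖ * Real.exp (-(z * e).re * t)
        ≤ C * Real.exp ((z * e).re / 2 * t) * Real.exp (-(z * e).re * t) := by gcongr
      _ = C * Real.exp (-((z * e).re / 2) * t) := by
          rw [mul_assoc, ← Real.exp_add]
          ring_nf
  have hint2 : MeasureTheory.IntegrableOn
      (fun t : ℝ => (c : ℂ) * e * Complex.exp (-(z * e) * t)) (Set.Ioi 0) :=
    (integrableOn_exp_mul_complex_Ioi hneg 0).const_mul _
  have hsplit : ∀ t : ℝ, (B (t * e) + c) * Complex.exp (-(t * e * z)) * e =
      B (t * e) * Complex.exp (-(t * e * z)) * e + c * e * Complex.exp (-(z * e) * t) := by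
    intro t
    rw [← hexp]
    ring
  simp only [hsplit]
  rw [MeasureTheory.integral_add hint1 hint2, MeasureTheory.integral_const_mul,
    integral_exp_mul_complex_Ioi hneg, mul_add, ← hw]
  simp only [Complex.ofReal_zero, mul_zero, Complex.exp_zero]
  field_simp

/-! ### Mellin transforms and derivatives of Γ -/

open MeasureTheory Asymptotics Filter in
/-- Iterated differentiation of a Mellin transform under the integral sign. -/
theorem mellin_log_pow_smul {g : ℝ → ℂ} (hg : LocallyIntegrableOn g (Set.Ioi 0))
    (htop : ∀ b : ℝ, g =O[atTop] (· ^ (-b))) (hbot : ∀ b : ℝ, 0 < b → g =O[𝓝[>] 0] (· ^ (-b)))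
    (k : ℕ) {z : ℂ} (hz : 0 < z.re) :
    MellinConvergent (fun t => Real.log t ^ k • g t) z ∧
      HasDerivAt (mellin fun t => Real.log t ^ k • g t)
        (mellin (fun t => Real.log t ^ (k + 1) • g t) z) z := by
  have hloc : ∀ k : ℕ, LocallyIntegrableOn (fun t => Real.log t ^ k • g t) (Set.Ioi 0) := by
    intro k
    refine hg.continuousOn_smul isOpen_Ioi.isLocallyClosed ?_
    exact (Real.continuousOn_log.mono fun t ht => ne_of_gt ht).pow k
  have hs : ∀ k : ℕ, (fun t => Real.log t ^ (k + 1) • g t) =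
      fun t => Real.log t • Real.log t ^ k • g t := by
    intro k
    ext t
    rw [smul_smul, pow_succ']
  have hO : ∀ k : ℕ, (∀ b : ℝ, (fun t => Real.log t ^ k • g t) =O[atTop] (· ^ (-b))) ∧
      ∀ b : ℝ, 0 < b → (fun t => Real.log t ^ k • g t) =O[𝓝[>] 0] (· ^ (-b)) := by
    intro k
    induction k with
    | zero => simpa using ⟨htop, hbot⟩
    | succ k ih =>
      rw [hs]
      exact ⟨fun b => isBigO_rpow_top_log_smul (lt_add_one b) (ih.1 _),
        fun b hb => isBigO_rpow_zero_log_smul (half_lt_self hb) (ih.2 _ (half_pos hb))⟩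
  refine ⟨mellinConvergent_of_isBigO_rpow (hloc k) ((hO k).1 _) (lt_add_one _)
    ((hO k).2 _ (half_pos hz)) (half_lt_self hz), ?_⟩
  rw [hs]
  exact (mellin_hasDerivAt_of_isBigO_rpow (hloc k) ((hO k).1 _) (lt_add_one _)
    ((hO k).2 _ (half_pos hz)) (half_lt_self hz)).2

open MeasureTheory Asymptotics Filter in
theorem mellin_log_pow_smul_exp (k : ℕ) {z : ℂ} (hz : 0 < z.re) :
    MellinConvergent (fun t => Real.log t ^ k • (Real.exp (-t) : ℂ)) z ∧
      HasDerivAt (mellin fun t => Real.log t ^ k • (Real.exp (-t) : ℂ))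
        (mellin (fun t => Real.log t ^ (k + 1) • (Real.exp (-t) : ℂ)) z) z := by
  refine mellin_log_pow_smul (g := fun t => (Real.exp (-t) : ℂ))
    ((show Continuous fun t : ℝ => (Real.exp (-t) : ℂ) by
      fun_prop).locallyIntegrable.locallyIntegrableOn _) ?_ ?_ k hz
  · intro b
    refine isBigO_norm_left.mp ?_
    simpa only [Complex.norm_real, Real.norm_eq_abs, Real.abs_exp, neg_one_mul] using
      (isLittleO_exp_neg_mul_rpow_atTop zero_lt_one (-b)).isBigO
  · intro b hb
    refine IsBigO.of_bound 1 ?_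
    filter_upwards [Ioo_mem_nhdsGT (zero_lt_one (α := ℝ))] with t ht
    rw [one_mul, Complex.norm_real, Real.norm_eq_abs, Real.abs_exp, Real.norm_eq_abs,
      abs_of_pos (Real.rpow_pos_of_pos ht.1 _)]
    exact (Real.exp_le_one_iff.mpr (by linarith [ht.1])).trans
      (Real.one_le_rpow_of_pos_of_le_one_of_nonpos ht.1 ht.2.le (by linarith))

-- For k = 0 the transform is 1/z; each further logarithm differentiates once.
open MeasureTheory Asymptotics Filter in
theorem mellin_log_pow_smul_indicator (k : ℕ) {z : ℂ} (hz : 0 < z.re) :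
    HasMellin (fun t => Real.log t ^ k • (Set.Ioc 0 1).indicator (fun _ => 1 : ℝ → ℂ) t) z
      ((-1) ^ k * k.factorial / z ^ (k + 1)) := by
  have key : ∀ (k : ℕ) {z : ℂ}, 0 < z.re → _ := fun k {z} hz =>
    mellin_log_pow_smul (g := (Set.Ioc 0 1).indicator (fun _ => 1 : ℝ → ℂ))
      (((integrable_indicator_iff measurableSet_Ioc).mpr
        (by simp)).locallyIntegrable.locallyIntegrableOn _) (by
        intro b
        refine (EventuallyEq.trans_isBigO ?_ (isBigO_zero _ _))
        filter_upwards [eventually_gt_atTop 1] with t ht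
        rw [Set.indicator_of_notMem (fun h => absurd h.2 (not_le.mpr ht))]) (by
        intro b hb
        refine IsBigO.of_bound 1 ?_
        filter_upwards [Ioo_mem_nhdsGT (zero_lt_one (α := ℝ))] with t ht
        have ht' : t ∈ Set.Ioc (0 : ℝ) 1 := ⟨ht.1, ht.2.le⟩
        rw [Set.indicator_of_mem ht', one_mul, norm_one,
          Real.norm_eq_abs, abs_of_pos (Real.rpow_pos_of_pos ht.1 _)]
        exact Real.one_le_rpow_of_pos_of_le_one_of_nonpos ht.1 ht.2.le (by linarith)) k hz
  refine ⟨(key k hz).1, ?_⟩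
  induction k generalizing z with
  | zero => simpa using (hasMellin_one_Ioc hz).2
  | succ k ih =>
    have hz0 : z ≠ 0 := by
      rintro rfl
      simp at hz
    have h1 : HasDerivAt (fun w : ℂ => (-1) ^ k * (k.factorial : ℂ) / w ^ (k + 1))
        ((-1) ^ (k + 1) * ((k + 1).factorial : ℂ) / z ^ (k + 1 + 1)) z := by
      have h2 := ((hasDerivAt_pow (k + 1) z).inv (pow_ne_zero _ hz0)).const_mul
        ((-1) ^ k * (k.factorial : ℂ))
      convert! h2 using 1
      rw [Nat.factorial_succ]
      push_cast
      field_simp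
      ring
    refine (key k hz).2.unique (h1.congr_of_eventuallyEq ?_)
    filter_upwards [(isOpen_lt continuous_const Complex.continuous_re).mem_nhds hz] with w hw
    exact ih hw

/-- Induction on s: the previous identity holds on the whole open half-plane, hence near z, and may
be differentiated. -/
theorem iteratedDeriv_Gamma_eq_mellin (s : ℕ) {z : ℂ} (hz : 0 < z.re) :
    iteratedDeriv s Complex.Gamma z =
      mellin (fun t => Real.log t ^ s • (Real.exp (-t) : ℂ)) z := by
  induction s generalizing z with
  | zero =>
    rw [iteratedDeriv_zero, Complex.Gamma_eq_integral hz, Complex.GammaIntegral_eq_mellin]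
    simp
  | succ s ih =>
    rw [iteratedDeriv_succ]
    refine ((mellin_log_pow_smul_exp s hz).2.congr_of_eventuallyEq ?_).deriv
    filter_upwards [(isOpen_lt continuous_const Complex.continuous_re).mem_nhds hz] with w hw
    exact ih hw

/-! ### Splitting the Gamma integral at 1 -/

-- Expand e^(-t) and exchange sum and integral, which is allowed because the integrals of the norms
-- are summable, being dominated by a multiple of 1/n!.
open MeasureTheory in
theorem hasSum_integral_Ioc_cpow_mul_log_pow_mul_exp (s : ℕ) {a : ℝ} (ha : 0 < a) :
    HasSum (fun n : ℕ => (-1) ^ n / (n.factorial : ℂ) *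
        ((-1) ^ s * s.factorial / ((n : ℂ) + a) ^ (s + 1)))
      (∫ t : ℝ in Set.Ioc 0 1, (t : ℂ) ^ ((a : ℂ) - 1) *
        ((Real.log t : ℂ) ^ s * (Real.exp (-t) : ℂ))) := by
  have hmellin : ∀ n : ℕ,
      IntegrableOn (fun t : ℝ => (t : ℂ) ^ ((n : ℂ) + a - 1) * (Real.log t : ℂ) ^ s)
        (Set.Ioc 0 1) ∧
      ∫ t : ℝ in Set.Ioc 0 1, (t : ℂ) ^ ((n : ℂ) + a - 1) * (Real.log t : ℂ) ^ s =
        (-1) ^ s * s.factorial / ((n : ℂ) + a) ^ (s + 1) := by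
    intro n
    obtain ⟨h1, h2⟩ := mellin_log_pow_smul_indicator s (z := (n : ℂ) + a) (by simp; positivity)
    have heq : ∀ t : ℝ, (t : ℂ) ^ ((n : ℂ) + a - 1) •
        (Real.log t ^ s • (Set.Ioc 0 1).indicator (fun _ => 1 : ℝ → ℂ) t) =
        (Set.Ioc (0 : ℝ) 1).indicator
          (fun t : ℝ => (t : ℂ) ^ ((n : ℂ) + a - 1) * (Real.log t : ℂ) ^ s) t := by
      intro t
      by_cases ht : t ∈ Set.Ioc (0 : ℝ) 1
      · simp [ht]
      · simp [ht]
    have hinter : Set.Ioi (0 : ℝ) ∩ Set.Ioc 0 1 = Set.Ioc 0 1 :=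
      Set.inter_eq_right.mpr Set.Ioc_subset_Ioi_self
    unfold MellinConvergent at h1
    unfold mellin at h2
    simp only [heq] at h1 h2
    rw [setIntegral_indicator measurableSet_Ioc, hinter] at h2
    rw [integrableOn_indicator_iff measurableSet_Ioc, Set.inter_comm, hinter] at h1
    exact ⟨h1, h2⟩
  set F : ℕ → ℝ → ℂ := fun n t => (-1) ^ n / (n.factorial : ℂ) *
    ((t : ℂ) ^ ((n : ℂ) + a - 1) * (Real.log t : ℂ) ^ s) with hF
  have hFint : ∀ n, IntegrableOn (F n) (Set.Ioc 0 1) := fun n => (hmellin n).1.const_mul _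
  have hnorm : ∀ n, ∫ t in Set.Ioc (0 : ℝ) 1, ‖F n t‖ =
      1 / n.factorial * (s.factorial / ((n : ℝ) + a) ^ (s + 1)) := by
    intro n
    -- On (0, 1] the logarithm has constant sign, so the norm is a constant multiple of the
    -- integrand and its integral is again given by the Mellin formula.
    have h1 : ∀ t ∈ Set.Ioc (0 : ℝ) 1, ((‖F n t‖ : ℝ) : ℂ) = 1 / (n.factorial : ℂ) * (-1) ^ s *
        ((t : ℂ) ^ ((n : ℂ) + a - 1) * (Real.log t : ℂ) ^ s) := by
      intro t ht
      have h2 : (t : ℂ) ^ ((n : ℂ) + a - 1) = ((t ^ ((n : ℝ) + a - 1) : ℝ) : ℂ) := by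
        rw [Complex.ofReal_cpow ht.1.le]
        push_cast
        rfl
      have h3 : |Real.log t| = - Real.log t := abs_of_nonpos (Real.log_nonpos ht.1.le ht.2)
      rw [hF]
      simp only [h2]
      rw [norm_mul, norm_mul, norm_div, norm_pow, norm_neg, norm_one, one_pow, norm_pow,
        Complex.norm_natCast, Complex.norm_real, Complex.norm_real, Real.norm_eq_abs,
        Real.norm_eq_abs, h3, abs_of_pos (Real.rpow_pos_of_pos ht.1 _), neg_pow]
      push_cast
      ring
    have h4 : ((∫ t in Set.Ioc (0 : ℝ) 1, ‖F n t‖ : ℝ) : ℂ) =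
        ((1 / n.factorial * (s.factorial / ((n : ℝ) + a) ^ (s + 1)) : ℝ) : ℂ) := by
      push_cast
      rw [← integral_complex_ofReal, setIntegral_congr_fun measurableSet_Ioc h1,
        integral_const_mul, (hmellin n).2]
      have h5 : ((-1 : ℂ) ^ s) * (-1) ^ s = 1 := by rw [← mul_pow]; simp
      linear_combination (1 / (n.factorial : ℂ) * (s.factorial / ((n : ℂ) + a) ^ (s + 1))) * h5
    exact Complex.ofReal_injective h4
  have hsum : Summable fun n => ∫ t in Set.Ioc (0 : ℝ) 1, ‖F n t‖ := by
    simp only [hnorm]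
    refine Summable.of_nonneg_of_le (fun n => by positivity) (fun n => ?_)
      ((Real.summable_pow_div_factorial 1).mul_right (s.factorial / a ^ (s + 1)))
    rw [one_pow]
    gcongr
    linarith [Nat.cast_nonneg (α := ℝ) n]
  have h := hasSum_integral_of_summable_integral_norm hFint hsum
  have hval : ∀ n, ∫ t in Set.Ioc (0 : ℝ) 1, F n t = (-1) ^ n / (n.factorial : ℂ) *
        ((-1) ^ s * s.factorial / ((n : ℂ) + a) ^ (s + 1)) := fun n => by
    rw [hF]
    simp only
    rw [integral_const_mul, (hmellin n).2]
  simp only [hval] at h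
  refine (congrArg (HasSum _) ?_).mpr h
  refine setIntegral_congr_fun measurableSet_Ioc fun t ht => ?_
  have ht0 : (t : ℂ) ≠ 0 := by exact_mod_cast ht.1.ne'
  have hexp := NormedSpace.expSeries_div_hasSum_exp (-(t : ℂ))
  rw [← Complex.exp_eq_exp_ℂ] at hexp
  have hexp' := hexp.mul_left ((t : ℂ) ^ ((a : ℂ) - 1) * (Real.log t : ℂ) ^ s)
  push_cast
  rw [← mul_assoc]
  refine hexp'.tsum_eq.symm.trans (tsum_congr fun n => ?_)
  rw [hF]
  dsimp only
  rw [show (n : ℂ) + a - 1 = n + ((a : ℂ) - 1) by ring, Complex.cpow_add _ _ ht0,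
    Complex.cpow_natCast, neg_pow]
  ring

open MeasureTheory in
theorem integral_Ioi_one_cpow_mul_log_pow_mul_exp (s : ℕ) (a : ℝ) :
    ∫ t : ℝ in Set.Ioi 1, (t : ℂ) ^ ((a : ℂ) - 1) *
        ((Real.log t : ℂ) ^ s * (Real.exp (-t) : ℂ)) =
      Complex.exp (-1) * ((∫ t in Set.Ioi (0 : ℝ),
          (1 + t) ^ (a - 1) * Real.log (1 + t) ^ s * Real.exp (-t) : ℝ) : ℂ) := by
  have h := (measurePreserving_add_left volume (1 : ℝ)).setIntegral_preimage_emb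
    (measurableEmbedding_addLeft 1) (fun t : ℝ => (t : ℂ) ^ ((a : ℂ) - 1) *
        ((Real.log t : ℂ) ^ s * (Real.exp (-t) : ℂ))) (Set.Ioi 1)
  rw [← h, ← integral_complex_ofReal, ← integral_const_mul]
  have hpre : (fun t : ℝ => 1 + t) ⁻¹' Set.Ioi 1 = Set.Ioi 0 := by
    ext t
    simp
  rw [hpre]
  refine setIntegral_congr_fun measurableSet_Ioi fun t ht => ?_
  have ht' : (0 : ℝ) ≤ 1 + t := by linarith [Set.mem_Ioi.mp ht]
  rw [neg_add, Real.exp_add]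
  push_cast
  rw [Complex.ofReal_cpow ht']
  push_cast
  ring

open MeasureTheory in
/-- The incomplete Gamma function decomposition of the derivatives of `Γ` at a positive rational,
together with the convergence of the series `E_{a,s+1}` at `-1`. -/
theorem exists_hasValueAt_seriesE_iteratedDeriv_Gamma (s : ℕ) {a : ℚ} (ha : 0 < a) :
    ∃ u : ℂ, HasValueAt (seriesE a (s + 1)) (-1) u ∧
      iteratedDeriv s Complex.Gamma (a : ℂ) = (-1) ^ s * (s.factorial : ℂ) * u +
        Complex.exp (-1) * ((∫ t in Set.Ioi (0 : ℝ),
          (1 + t) ^ ((a : ℝ) - 1) * Real.log (1 + t) ^ s * Real.exp (-t) : ℝ) : ℂ) := by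
  have ha' : (0 : ℝ) < a := by exact_mod_cast ha
  have hcast : (a : ℂ) = ((a : ℝ) : ℂ) := by norm_cast
  have hre : 0 < (((a : ℝ) : ℂ)).re := ha'
  have hsum := hasSum_integral_Ioc_cpow_mul_log_pow_mul_exp s ha'
  set I := ∫ t : ℝ in Set.Ioc 0 1, (t : ℂ) ^ (((a : ℝ) : ℂ) - 1) *
        ((Real.log t : ℂ) ^ s * (Real.exp (-t) : ℂ)) with hI
  have hc : (-1 : ℂ) ^ s * (s.factorial : ℂ) ≠ 0 :=
    mul_ne_zero (pow_ne_zero _ (by norm_num)) (by exact_mod_cast s.factorial_ne_zero)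
  -- The value of the E-function is read off from the integral over (0, 1], whose termwise expansion
  -- carries the extra factor (-1)^s s!.
  refine ⟨((-1) ^ s * (s.factorial : ℂ))⁻¹ * I, ?_, ?_⟩
  · refine hasValueAt_of_hasSum (hsum.mul_left _) fun n => ?_
    have hs : (s.factorial : ℂ) ≠ 0 := by exact_mod_cast s.factorial_ne_zero
    rw [seriesE, PowerSeries.coeff_mk]
    push_cast
    field_simp
  · have hconv := (mellin_log_pow_smul_exp s hre).1
    have heq : ∀ t : ℝ, (t : ℂ) ^ (((a : ℝ) : ℂ) - 1) •
        (Real.log t ^ s • (Real.exp (-t) : ℂ)) = (t : ℂ) ^ (((a : ℝ) : ℂ) - 1) *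
        ((Real.log t : ℂ) ^ s * (Real.exp (-t) : ℂ)) := by
      intro t
      rw [smul_eq_mul, Complex.real_smul]
      push_cast
      rfl
    unfold MellinConvergent at hconv
    simp only [heq] at hconv
    rw [hcast, iteratedDeriv_Gamma_eq_mellin s hre, mellin]
    simp only [heq]
    rw [← Set.Ioc_union_Ioi_eq_Ioi (zero_le_one (α := ℝ)),
      setIntegral_union (Set.Ioc_disjoint_Ioi le_rfl) measurableSet_Ioi
        (hconv.mono_set Set.Ioc_subset_Ioi_self)
        (hconv.mono_set (Set.Ioi_subset_Ioi zero_le_one)),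
      integral_Ioi_one_cpow_mul_log_pow_mul_exp, ← hI, mul_inv_cancel_left₀ hc,
      Set.Ioc_union_Ioi_eq_Ioi (zero_le_one (α := ℝ))]

/-! ### Mixed values are sums of values from E and D -/

theorem IsAntieFunction.add_C {f : Qbar⟦X⟧} (hf : IsAntieFunction f) (c : Qbar) :
    IsAntieFunction (f + PowerSeries.C c) := by
  change IsEFunction (borelTransform (borelTransform (f + PowerSeries.C c)))
  rw [borelTransform_add, borelTransform_add, borelTransform_C, borelTransform_C]
  have h : IsEFunction (borelTransform (borelTransform f)) := hf
  simpa using h.affine 1 1 c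

/-- The index 0 belongs to the plus part, so f must have no constant term. -/
theorem exists_plusPart_minusPart_eq (F f : Qbar⟦X⟧) (hf : PowerSeries.coeff 0 f = 0) :
    ∃ Ψ : ℤ → Qbar, plusPart Ψ = F ∧ minusPart Ψ = f := by
  refine ⟨fun n => if 0 ≤ n then PowerSeries.coeff n.toNat F else
    PowerSeries.coeff (-n).toNat f, ?_, ?_⟩
  · ext n : 1
    simp [plusPart]
  · ext n : 1
    rw [minusPart, PowerSeries.coeff_mk]
    split_ifs with h h'
    · rw [h, hf]
    · omega
    · simp

theorem valuesMixed_subset : valuesMixed ⊆ valuesE + valuesD := by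
  rintro w ⟨Ψ, ⟨hF, hf⟩, ⟨hns, u, v, hu, hv, rfl⟩ | ⟨hs, hev⟩⟩
  · exact Set.add_mem_add ⟨_, hF, 1, by simpa using hu⟩ ⟨_, hf, Or.inl ⟨hns, hv⟩⟩
  -- The value u of the E-part does not depend on θ, by uniqueness of sums; so w - u is the 1-sum
  -- for all small θ > 0.
  · obtain ⟨θ, u, -, hu, -, -⟩ := hev.exists
    refine ⟨u, ⟨_, hF, 1, by simpa using hu⟩, w - u, ⟨_, hf, Or.inr ⟨hs, ?_⟩⟩, by simp⟩
    filter_upwards [hev] with θ hθ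
    obtain ⟨u', v, hu', hv, rfl⟩ := hθ
    obtain rfl : u' = u := HasSum.unique hu' hu
    simpa using hv

theorem valuesE_add_valuesD_subset : valuesE + valuesD ⊆ valuesMixed := by
  rintro _ ⟨u, ⟨F, hF, ξ, hu⟩, v, ⟨f, hf, hv⟩, rfl⟩
  set c := PowerSeries.coeff 0 f with hc
  -- The constant term c of f moves to the E-part, and the point ξ is scaled to 1. Neither the total
  -- value nor the anti-Stokes property changes.
  obtain ⟨Ψ, hplus, hminus⟩ := exists_plusPart_minusPart_eq
    (PowerSeries.C 1 * PowerSeries.rescale ξ F + PowerSeries.C c) (f + PowerSeries.C (-c))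
    (by simp [hc])
  have hu' : HasValueAt (plusPart Ψ) 1 (u + c) := by
    rw [hplus]
    simpa using HasValueAt.affine (z := 1) (ξ := ξ) (by simpa using hu) 1 c
  have hval : ∀ θ : ℝ, HasOneSumAt f θ 1 v → MixedHasValueAt Ψ θ 1 (u + v) := fun θ h =>
    ⟨u + c, v + (-c : Qbar), hu', by rw [hminus]; exact h.add_C (-c), by push_cast; ring⟩
  refine ⟨Ψ, ⟨by rw [hplus]; exact hF.affine 1 ξ c, by rw [hminus]; exact hf.add_C (-c)⟩, ?_⟩
  rw [hminus, isAntiStokes_add_C_iff]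
  rcases hv with ⟨hns, hv⟩ | ⟨hs, hv⟩
  · exact Or.inl ⟨hns, hval 0 hv⟩
  · exact Or.inr ⟨hs, hv.mono hval⟩

theorem mainTheorem8 :
    valuesMixed = valuesE + valuesD ∧
    ∀ (s : ℕ) (a : ℚ), 0 < a →
      iteratedDeriv s Complex.Gamma (a : ℂ) ∈ Complex.exp (-1) • valuesMixed ∧
      IsEFunction (seriesE a (s + 1)) ∧
      IsAntieFunction (seriesAntie a s) ∧
      ¬ IsAntiStokes (seriesAntie a s) 0 ∧
      ∃ u v : ℂ,
        HasValueAt (seriesE a (s + 1)) (-1) u ∧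
        HasOneSumAt (seriesAntie a s) 0 1 v ∧
        v = ((∫ t in Set.Ioi (0 : ℝ),
          (1 + t) ^ ((a : ℝ) - 1) * Real.log (1 + t) ^ s * Real.exp (-t) : ℝ) : ℂ) ∧
        iteratedDeriv s Complex.Gamma (a : ℂ) =
          (-1) ^ s * (s.factorial : ℂ) * u + Complex.exp (-1) * v := by
  refine ⟨valuesMixed_subset.antisymm valuesE_add_valuesD_subset, fun s a ha => ?_⟩
  obtain ⟨u, hu, hΓ⟩ := exists_hasValueAt_seriesE_iteratedDeriv_Gamma s ha
  have hns : ¬ IsAntiStokes (seriesAntie a s) 0 :=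
    not_not.mpr ⟨_, isBorelContinuation_seriesAntie a s⟩
  have hv := hasOneSumAt_seriesAntie a s
  refine ⟨?_, isEFunction_seriesE ha _, isAntieFunction_seriesAntie a s, hns, u, _, hu, hv, rfl,
    hΓ⟩
  set v := ((∫ t in Set.Ioi (0 : ℝ),
    (1 + t) ^ ((a : ℝ) - 1) * Real.log (1 + t) ^ s * Real.exp (-t) : ℝ) : ℂ)
  -- The formula for the Gamma derivative is multiplied by e, so its first term acquires the factor
  -- e and must still be a value of an E-function.
  have hE : (-1) ^ s * (s.factorial : ℂ) * (Complex.exp 1 * u) ∈ valuesE := by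
    refine ⟨_, (isEFunction_expNegSeries_mul_seriesE ha (s + 1)).affine
      ((-1) ^ s * (s.factorial : Qbar)) 1 0, -1, ?_⟩
    have h1 : HasValueAt (expNegSeries * seriesE a (s + 1)) (-1) (Complex.exp 1 * u) := by
      have := (hasValueAt_expNegSeries (-1)).mul hu
      rwa [neg_neg] at this
    have h2 := HasValueAt.affine (ξ := 1) (z := -1) (by simpa using h1)
      ((-1) ^ s * (s.factorial : Qbar)) 0
    simpa using h2
  refine ⟨_, valuesE_add_valuesD_subset (Set.add_mem_add hE
    ⟨_, isAntieFunction_seriesAntie a s, Or.inl ⟨hns, hv⟩⟩), ?_⟩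
  have hexp : Complex.exp (-1) * Complex.exp 1 = 1 := by rw [← Complex.exp_add]; simp
  dsimp only
  rw [hΓ, smul_eq_mul]
  linear_combination ((-1) ^ s * (s.factorial : ℂ) * u) * hexp
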